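/- Let $\mathcal P_2(\mathbb R^d)$ be the set of Borel probability measures on $\mathbb R^d$ with finite second moment, $W_2$ the type-2 Wasserstein distance, and $\Gamma_o(\mu,\nu)$ the set of optimal transport plans between $\mu$ and $\nu$ for the cost $\|x-y\|^2$. Let $J:\mathcal P_2(\mathbb R^d)\to\mathbb R$ and assume: (a) $J$ is Wasserstein differentiable: for every $\mu$ there is $\nabla_\mu J(\mu)\in L^2(\mathbb R^d,\mathbb R^d;\mu)$ with $$J(\nu)-J(\mu)=\int \nabla_\mu J(\mu)(x)^\top(y-x)\,d\gamma(x,y)+o(W_2(\mu,\nu))\quad\text{for all }\gamma\in\Gamma_o(\mu,\nu);$$ fix such a gradient for each $\mu$. (b) $J$ is $\alpha$-geodesically convex with $\alpha>0$: for all $\mu_0,\mu_1\in\mathcal P_2(\mathbb R^d)$ there is a geodesic $\mu_t=((1-t)\mathrm{proj}_1+t\,\mathrm{proj}_2)_\#\gamma$, $\gamma\in\Gamma_o(\mu_0,\mu_1)$, with $J(\mu_t)\le(1-t)J(\mu_0)+tJ(\mu_1)-\frac\alpha2t(1-t)W_2(\mu_0,\mu_1)^2$ for all $t\in[0,1]$.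 (c) $\Theta\subset\mathbb R^d$ is closed and convex, and $\mu^\ast$ minimizes $J$ over $\{\mu\in\mathcal P_2(\mathbb R^d):\operatorname{supp}\mu\subset\Theta\}$. Let $\tau>0$, $\mu_0\in\mathcal P_2(\mathbb R^d)$, and let random measures $\mu_k\in\mathcal P_2(\mathbb R^d)$ be produced from random vector fields $\xi_k:\mathbb R^d\to\mathbb R^d$, adapted to a filtration $(\mathcal F_k)_{k\ge0}$ of a standard Borel probability space ($\xi_k$ is $\mathcal F_{k+1}$-measurable, jointly in the sample and the space variable), by $$\mu_{k+1}=\mathrm{proj}_{\mathrm{supp}\subset\Theta}\big[(\mathrm{Id}-\tau\xi_k)_\#\mu_k\big]\quad\text{almost surely},\ k\ge0,$$ where $\mathrm{proj}_{\mathrm{supp}\subset\Theta}[\nu]$ is a minimizer of $\bar\mu\mapsto W_2(\nu,\bar\mu)$ over $\bar\mu\in\mathcal P_2(\mathbb R^d)$ with $\operatorname{supp}\bar\mu\subset\Theta$. Assume that the gradient estimates are unbiased, $\mathbb E[\xi_k\mid\mathcal F_k]=\nabla_\mu J(\mu_k)$ ($\mu_k$-almost everywhere), and that for some $\sigma>0$,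 $C>0$ and all $k$ $$\mathbb E\big[\|\xi_k\|_{L^2(\mathbb R^d,\mathbb R^d;\mu_k)}^2\mid\mathcal F_k\big]\le\sigma^2+C\,(J(\mu_k)-J(\mu^\ast))\quad\text{almost surely}$$ (for $k=0$ with the right-hand side replaced by its positive part), where the conditional expectations are taken with respect to a regular conditional probability given $\mathcal F_k$ and with $\mu_k$ held fixed. Let $\tau<\min\{1/\alpha,2/C\}$. Then $W_2(\mu_{k+1},\mu^\ast)^2$ is integrable for all $k\ge0$ and, if $J(\mu_0)\ge J(\mu^\ast)$ (for instance if $\operatorname{supp}\mu_0\subset\Theta$), then for all $k\ge0$ $$\mathbb E\big[W_2(\mu_{k+1},\mu^\ast)^2\big]\le(1-\tau\alpha)^{k+1}\Big(W_2(\mu_0,\mu^\ast)^2-\frac{\tau\sigma^2}{\alpha}\Big)+\frac{\tau\sigma^2}{\alpha}.$$ For arbitrary $\mu_0\in\mathcal P_2(\mathbb R^d)$ and all $k\ge0$, $$\mathbb E\big[W_2(\mu_{k+1},\mu^\ast)^2\big]\le(1-\tau\alpha)^{k}\Big(\mathbb E\big[W_2(\mu_1,\mu^\ast)^2\big]-\frac{\tau\sigma^2}{\alpha}\Big)+\frac{\tau\sigma^2}{\alpha}.$$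 In particular, for arbitrary $\mu_0\in\mathcal P_2(\mathbb R^d)$, the following expectations are of integrable random variables and: 1. $\displaystyle\limsup_{k\to\infty}\mathbb E\big[W_2(\mu_{k+1},\mu^\ast)\big]\le\sqrt{\tau\sigma^2/\alpha}$. 2. $\displaystyle\limsup_{k\to\infty}\mathbb E\Big[\sqrt{\|m_{k+1}-m^\ast\|^2+d(S_{k+1},S^\ast)^2}\Big]\le\sqrt{\tau\sigma^2/\alpha}$, where $m_k,m^\ast$ are the means and $S_k,S^\ast$ the covariance matrices of $\mu_k,\mu^\ast$, and $d(A,B)=\sqrt{\operatorname{tr}\big(A+B-2(A^{1/2}BA^{1/2})^{1/2}\big)}$ is the Bures distance. 3. For every $L$-Lipschitz $\varphi:\mathbb R^d\to\mathbb R$, $\displaystyle\limsup_{k\to\infty}\mathbb E\Big[\big|\|\varphi\|_{L^2(\mu_{k+1})}-\|\varphi\|_{L^2(\mu^\ast)}\big|\Big]\le L\sqrt{\tau\sigma^2/\alpha}$, where $\|\varphi\|_{L^2(\nu)}^2=\int\varphi^2\,d\nu$. -/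

import Mathlib

open MeasureTheory ProbabilityTheory Filter Topology
open scoped NNReal ENNReal MatrixOrder

noncomputable section

namespace WassersteinGF

/-- The Euclidean space `ℝᵈ`. -/
abbrev E (d : ℕ) : Type := EuclideanSpace ℝ (Fin d)

/-- Borel probability measures on `ℝᵈ` with finite second moment. -/
def P2 (d : ℕ) : Type :=
  {μ : Measure (E d) // IsProbabilityMeasure μ ∧ ∫⁻ x, ‖x‖ₑ ^ 2 ∂μ < ∞}

instance (d : ℕ) : CoeOut (P2 d) (Measure (E d)) := ⟨Subtype.val⟩

/-- Transport plans: measures on `ℝᵈ × ℝᵈ` with marginals `μ` and `ν`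
(they are probability measures as soon as `μ` is one). -/
def plans {d : ℕ} (μ ν : Measure (E d)) : Set (Measure (E d × E d)) :=
  {γ | γ.map Prod.fst = μ ∧ γ.map Prod.snd = ν}

/-- Quadratic transport cost of a plan. -/
def cost {d : ℕ} (γ : Measure (E d × E d)) : ℝ≥0∞ :=
  ∫⁻ p, ‖p.1 - p.2‖ₑ ^ 2 ∂γ

/-- Optimal transport plans between `μ` and `ν`. -/
def optimalPlans {d : ℕ} (μ ν : Measure (E d)) : Set (Measure (E d × E d)) :=
  {γ | γ ∈ plans μ ν ∧ ∀ γ' ∈ plans μ ν, cost γ ≤ cost γ'}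

/-- Type 2 Wasserstein distance between arbitrary measures, possibly infinite. -/
def eW2 {d : ℕ} (μ ν : Measure (E d)) : ℝ≥0∞ :=
  (⨅ γ ∈ plans μ ν, cost γ) ^ (1 / 2 : ℝ)

/-- Type 2 Wasserstein distance on `P2 d` (where it is finite). -/
def W2 {d : ℕ} (μ ν : P2 d) : ℝ :=
  (eW2 (μ : Measure (E d)) (ν : Measure (E d))).toReal

/-- `m` is a geodesic from `μ₀` to `μ₁`: the displacement interpolation along an optimal plan. -/
def IsGeodesic {d : ℕ} (m : ℝ → P2 d) (μ₀ μ₁ : P2 d) : Prop :=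
  ∃ γ ∈ optimalPlans (μ₀ : Measure (E d)) (μ₁ : Measure (E d)), ∀ t ∈ Set.Icc (0 : ℝ) 1,
    (m t : Measure (E d)) = γ.map (fun p => (1 - t) • p.1 + t • p.2)

/-- `α`-geodesic convexity: any two measures are joined by some geodesic along which `J` is
`α`-convex. -/
def GeodesicallyConvex {d : ℕ} (α : ℝ) (J : P2 d → ℝ) : Prop :=
  ∀ μ₀ μ₁ : P2 d, ∃ m : ℝ → P2 d, IsGeodesic m μ₀ μ₁ ∧ ∀ t ∈ Set.Icc (0 : ℝ) 1,
    J (m t) ≤ (1 - t) * J μ₀ + t * J μ₁ - α / 2 * t * (1 - t) * W2 μ₀ μ₁ ^ 2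

/-- `g ∈ L²(ℝᵈ, ℝᵈ; μ)` is a Wasserstein gradient of `J` at `μ`:
`J(ν) - J(μ) = ∫ ⟨g(x), y - x⟩ dγ(x, y) + o(W₂(μ, ν))` for all optimal plans `γ`. -/
def IsWassersteinGradient {d : ℕ} (J : P2 d → ℝ) (μ : P2 d) (g : E d → E d) : Prop :=
  MemLp g 2 (μ : Measure (E d)) ∧
  ∀ ε > 0, ∃ δ > 0, ∀ ν : P2 d, W2 μ ν < δ →
    ∀ γ ∈ optimalPlans (μ : Measure (E d)) (ν : Measure (E d)),
      |J ν - J μ - ∫ p, inner ℝ (g p.1) (p.2 - p.1) ∂γ| ≤ ε * W2 μ ν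

/-- `μ` solves: minimize `J` over `P2 d` subject to `supp μ ⊆ Θ`. -/
def IsOptimal {d : ℕ} (J : P2 d → ℝ) (Θ : Set (E d)) (μ : P2 d) : Prop :=
  (μ : Measure (E d)).support ⊆ Θ ∧
  ∀ ν : P2 d, (ν : Measure (E d)).support ⊆ Θ → J μ ≤ J ν

/-- `μ` is a Wasserstein projection of `ν` onto the set of measures supported in `Θ`. -/
def IsWassersteinProjection {d : ℕ} (Θ : Set (E d)) (ν : Measure (E d)) (μ : P2 d) : Prop :=
  (μ : Measure (E d)).support ⊆ Θ ∧
  ∀ μ' : P2 d, (μ' : Measure (E d)).support ⊆ Θ →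
    eW2 ν (μ : Measure (E d)) ≤ eW2 ν (μ' : Measure (E d))

section Iteration

variable {Ω : Type*} [mΩ : MeasurableSpace Ω]

/-- `μ` is produced by the stochastic projected Wasserstein gradient iteration with step size `τ`,
gradient estimates `ξ` and initial measure `μ₀`. The estimate `ξ k` is revealed between times `k`
and `k + 1` of the filtration `ℱ`, and the iteration holds almost surely. -/
structure IsIteration {d : ℕ} (P : Measure Ω) (ℱ : Filtration ℕ mΩ) (Θ : Set (E d)) (τ : ℝ)
    (ξ : ℕ → Ω → E d → E d) (μ₀ : P2 d) (μ : ℕ → Ω → P2 d) : Prop where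
  measurable : ∀ k, Measurable[(ℱ (k + 1)).prod inferInstance]
    (fun p : Ω × E d => ξ k p.1 p.2)
  init : ∀ᵐ ω ∂P, μ 0 ω = μ₀
  step : ∀ k, ∀ᵐ ω ∂P, IsWassersteinProjection Θ
    ((μ k ω : Measure (E d)).map (fun x => x - τ • ξ k ω x)) (μ (k + 1) ω)

/-- Unbiasedness: given the past, the mean of the random field `ξ k` is the gradient of `J` at the
current measure (as elements of `L²(μ k)`). -/
def IsUnbiased [StandardBorelSpace Ω] {d : ℕ} (P : Measure Ω) [IsFiniteMeasure P]
    (ℱ : Filtration ℕ mΩ) (grad : P2 d → E d → E d)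
    (ξ : ℕ → Ω → E d → E d) (μ : ℕ → Ω → P2 d) : Prop :=
  ∀ k, ∀ᵐ ω ∂P, ∀ᵐ x ∂(μ k ω : Measure (E d)),
    ∫ ω', ξ k ω' x ∂(condExpKernel P (ℱ k) ω) = grad (μ k ω) x

/-- Second moment bound: given the past, the mean of `‖ξ k‖²` in `L²(μ k)` is at most
`σ² + C (J(μ k) - J(μ⋆))`. -/
def HasSecondMomentBound [StandardBorelSpace Ω] {d : ℕ} (P : Measure Ω) [IsFiniteMeasure P]
    (ℱ : Filtration ℕ mΩ) (J : P2 d → ℝ) (μstar : P2 d) (σ C : ℝ)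
    (ξ : ℕ → Ω → E d → E d) (μ : ℕ → Ω → P2 d) : Prop :=
  ∀ k, ∀ᵐ ω ∂P,
    ∫⁻ ω', eLpNorm (ξ k ω') 2 (μ k ω : Measure (E d)) ^ 2 ∂(condExpKernel P (ℱ k) ω)
      ≤ ENNReal.ofReal (σ ^ 2 + C * (J (μ k ω) - J μstar))

end Iteration

/-- Mean of a measure. -/
def mean {d : ℕ} (μ : P2 d) : E d := ∫ x, x ∂(μ : Measure (E d))

/-- Covariance matrix of a measure. -/
def covMatrix {d : ℕ} (μ : P2 d) : Matrix (Fin d) (Fin d) ℝ :=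
  Matrix.of fun i j =>
    ∫ x, (x i - mean μ i) * (x j - mean μ j) ∂(μ : Measure (E d))

/-- Bures distance between positive semidefinite matrices. -/
def bures {d : ℕ} (A B : Matrix (Fin d) (Fin d) ℝ) : ℝ :=
  Real.sqrt (Matrix.trace
    (A + B - (2 : ℝ) • CFC.sqrt (CFC.sqrt A * B * CFC.sqrt A)))

/-- The norm of `φ` in `L²(μ)`. -/
def l2norm {d : ℕ} (φ : E d → ℝ) (μ : P2 d) : ℝ :=
  Real.sqrt (∫ x, φ x ^ 2 ∂(μ : Measure (E d)))

end WassersteinGF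

end

open WassersteinGF

namespace WassersteinGF

/-! The proof is the contraction argument for projected stochastic gradient descent, carried out
along optimal plans. Fix an optimal plan `γ` from `μ k` to `μstar`. The Wasserstein projection is
the pushforward by the nearest-point map of `Θ` (`IsWassersteinProjection.eq_map`), which is
nonexpansive and fixes `Θ`, so `γ` bounds the new squared distance by `∫ ‖x - τ ξ(x) - y‖² dγ`.
Conditional expectation and unbiasedness turn this into `W² + 2τ ∫ ⟨∇J, y - x⟩ dγ + τ² E‖ξ‖²`
(`lintegral_eLpNorm_gradient_step_le`).

Strong convexity in first-order form (`exists_optimalPlan_gradient_inequality`) bounds the cross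
term by `-2τ (J μ - J μstar) - τα W²`. With the moment bound, the `J` terms add up to `-τ(2 - τC)(J
μ - J μstar)`, which is nonpositive once `J μ ≥ J μstar`. What remains is `E W² ≤ (1 - τα) W² +
τ²σ²`, with fixed point `τσ²/α`. Every iterate after the initial one is supported in `Θ`, so only
the step from `μ₀` may need a separate assumption.

The asymptotic claims follow by Jensen, since each quantity is dominated by `W2` up to a constant:
Gelbrich's inequality for means and covariances, Minkowski's for `L²` norms.

The `μ k` are not assumed measurable. The explicit form of the projection yields adapted kernel
versions (`IsIteration.exists_isVersion`), and the regular conditional probability treats such a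
version as constant (`ae_condExpKernel_eq_measure`). Measurability of the distance itself comes from
approximation by atomic measures (`aemeasurable_eW2`). -/

/-! ### Transport plans, gluing and the Wasserstein distance. -/

/-- The `L²` size of the displacement of a plan, i.e. the square root of its cost. -/
noncomputable def displacement {d : ℕ} (γ : Measure (E d × E d)) : ℝ≥0∞ :=
  eLpNorm (fun p : E d × E d => p.1 - p.2) 2 γ

theorem eLpNorm_two_sq {Z F : Type*} [MeasurableSpace Z] [NormedAddCommGroup F]
    (f : Z → F) (m : Measure Z) : eLpNorm f 2 m ^ 2 = ∫⁻ z, ‖f z‖ₑ ^ 2 ∂m := by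
  have := eLpNorm_nnreal_pow_eq_lintegral (f := f) (μ := m) (p := 2) (by norm_num)
  simpa using this

theorem displacement_sq {d : ℕ} (γ : Measure (E d × E d)) : displacement γ ^ 2 = cost γ :=
  eLpNorm_two_sq _ _

theorem eW2_sq {d : ℕ} (μ ν : Measure (E d)) : eW2 μ ν ^ 2 = ⨅ γ ∈ plans μ ν, cost γ := by
  rw [eW2, ← ENNReal.rpow_natCast, ← ENNReal.rpow_mul]
  norm_num

theorem eW2_le_displacement {d : ℕ} {μ ν : Measure (E d)} {γ : Measure (E d × E d)}
    (h : γ ∈ plans μ ν) : eW2 μ ν ≤ displacement γ := by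
  rw [← ENNReal.pow_le_pow_left_iff (n := 2) (by norm_num), eW2_sq, displacement_sq]
  exact iInf₂_le γ h

theorem eW2_eq_displacement {d : ℕ} {μ ν : Measure (E d)} {γ : Measure (E d × E d)}
    (h : γ ∈ optimalPlans μ ν) : eW2 μ ν = displacement γ := by
  refine le_antisymm (eW2_le_displacement h.1) ?_
  rw [← ENNReal.pow_le_pow_left_iff (n := 2) (by norm_num), eW2_sq, displacement_sq]
  exact le_iInf₂ h.2

theorem exists_plan_displacement_lt {d : ℕ} {μ ν : Measure (E d)} {c : ℝ≥0∞}
    (h : eW2 μ ν < c) : ∃ γ ∈ plans μ ν, displacement γ < c := by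
  have h2 : eW2 μ ν ^ 2 < c ^ 2 := (ENNReal.pow_lt_pow_left_iff (by norm_num)).2 h
  rw [eW2_sq] at h2
  simp only [iInf_lt_iff] at h2
  obtain ⟨γ, hγ, hlt⟩ := h2
  refine ⟨γ, hγ, ?_⟩
  rwa [← displacement_sq, ENNReal.pow_lt_pow_left_iff (by norm_num)] at hlt

theorem mem_optimalPlans_of_displacement_le {d : ℕ} {μ ν : Measure (E d)}
    {γ : Measure (E d × E d)} (h : γ ∈ plans μ ν) (hle : displacement γ ≤ eW2 μ ν) :
    γ ∈ optimalPlans μ ν := by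
  refine ⟨h, fun γ' hγ' => ?_⟩
  rw [← displacement_sq, ← displacement_sq]
  gcongr
  exact hle.trans (eW2_le_displacement hγ')

theorem swap_mem_plans {d : ℕ} {μ ν : Measure (E d)} {γ : Measure (E d × E d)}
    (h : γ ∈ plans μ ν) : γ.map Prod.swap ∈ plans ν μ := by
  constructor
  · rw [Measure.map_map measurable_fst measurable_swap]; exact h.2
  · rw [Measure.map_map measurable_snd measurable_swap]; exact h.1

theorem displacement_map {d : ℕ} {Z : Type*} [MeasurableSpace Z] (m : Measure Z)
    {f : Z → E d × E d} (hf : Measurable f) :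
    displacement (m.map f) = eLpNorm (fun z => (f z).1 - (f z).2) 2 m := by
  rw [displacement, eLpNorm_map_measure (by fun_prop) hf.aemeasurable]
  rfl

theorem eW2_comm {d : ℕ} (μ ν : Measure (E d)) : eW2 μ ν = eW2 ν μ := by
  have key : ∀ μ ν : Measure (E d), eW2 μ ν ≤ eW2 ν μ := by
    intro μ ν
    refine le_of_forall_gt fun c hc => ?_
    obtain ⟨γ, hγ, hlt⟩ := exists_plan_displacement_lt hc
    refine (eW2_le_displacement (swap_mem_plans hγ)).trans_lt ?_
    rw [displacement_map _ measurable_swap]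
    convert hlt using 1
    rw [displacement, ← eLpNorm_neg]
    congr 1
    ext p : 1
    simp
  exact le_antisymm (key _ _) (key _ _)

theorem isProbabilityMeasure_of_mem_plans {d : ℕ} {μ ν : Measure (E d)}
    {γ : Measure (E d × E d)} (h : γ ∈ plans μ ν) [IsProbabilityMeasure μ] :
    IsProbabilityMeasure γ := by
  refine ⟨?_⟩
  have := measure_univ (μ := μ)
  rw [← h.1, Measure.map_apply measurable_fst MeasurableSet.univ] at this
  simpa using this

theorem prod_mem_plans {d : ℕ} (μ ν : Measure (E d)) [IsProbabilityMeasure μ]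
    [IsProbabilityMeasure ν] : μ.prod ν ∈ plans μ ν :=
  ⟨by simp [Measure.map_fst_prod], by simp [Measure.map_snd_prod]⟩

theorem map_prodMk_mem_plans {d : ℕ} {Z : Type*} [MeasurableSpace Z] (m : Measure Z)
    {f g : Z → E d} (hf : Measurable f) (hg : Measurable g) :
    m.map (fun z => (f z, g z)) ∈ plans (m.map f) (m.map g) := by
  constructor
  · rw [Measure.map_map measurable_fst (by fun_prop)]; rfl
  · rw [Measure.map_map measurable_snd (by fun_prop)]; rfl

/-- Two maps defined on the same measure space couple their image measures. -/
theorem eW2_map_map_le {d : ℕ} {Z : Type*} [MeasurableSpace Z] (m : Measure Z)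
    {f g : Z → E d} (hf : Measurable f) (hg : Measurable g) :
    eW2 (m.map f) (m.map g) ≤ eLpNorm (fun z => f z - g z) 2 m := by
  have := eW2_le_displacement (map_prodMk_mem_plans m hf hg)
  rwa [displacement_map _ (by fun_prop)] at this

theorem eLpNorm_comp_fst_of_mem_plans {d : ℕ} {F : Type*} [NormedAddCommGroup F]
    {μ ν : Measure (E d)} {γ : Measure (E d × E d)} (h : γ ∈ plans μ ν) {f : E d → F}
    (hf : AEStronglyMeasurable f μ) : eLpNorm (fun p => f p.1) 2 γ = eLpNorm f 2 μ := by
  have := h.1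
  subst this
  rw [eLpNorm_map_measure hf measurable_fst.aemeasurable]
  rfl

theorem eLpNorm_comp_snd_of_mem_plans {d : ℕ} {F : Type*} [NormedAddCommGroup F]
    {μ ν : Measure (E d)} {γ : Measure (E d × E d)} (h : γ ∈ plans μ ν) {f : E d → F}
    (hf : AEStronglyMeasurable f ν) : eLpNorm (fun p => f p.2) 2 γ = eLpNorm f 2 ν := by
  have := h.2
  subst this
  rw [eLpNorm_map_measure hf measurable_snd.aemeasurable]
  rfl

/-- Gluing of two plans along their common marginal. -/
theorem exists_gluing {d : ℕ} {μ₁ μ₂ μ₃ : Measure (E d)} [IsProbabilityMeasure μ₂]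
    {γ γ' : Measure (E d × E d)} (h : γ ∈ plans μ₁ μ₂) (h' : γ' ∈ plans μ₂ μ₃) :
    ∃ Γ : Measure ((E d × E d) × E d), Γ.map Prod.fst = γ ∧
      Γ.map (fun p => (p.1.2, p.2)) = γ' := by
  have : IsProbabilityMeasure γ' := isProbabilityMeasure_of_mem_plans h'
  have : IsProbabilityMeasure (γ.map Prod.snd) := by rw [h.2]; infer_instance
  have : IsProbabilityMeasure γ :=
    ⟨by simpa [Measure.map_apply measurable_snd] using measure_univ (μ := γ.map Prod.snd)⟩
  have hdis : γ'.fst ⊗ₘ γ'.condKernel = γ' := γ'.disintegrate γ'.condKernel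
  have hfst : γ'.fst = γ.map Prod.snd := h'.1.trans h.2.symm
  -- Given a pair drawn from `γ`, the third point is drawn from the conditional law of `γ'` at the
  -- second point.
  refine ⟨γ ⊗ₘ (γ'.condKernel.comap Prod.snd measurable_snd), ?_, ?_⟩
  · exact Measure.fst_compProd _ _
  · rw [hfst] at hdis
    conv_rhs => rw [← hdis]
    ext s hs
    rw [Measure.map_apply (by fun_prop) hs, Measure.compProd_apply hs,
      Measure.compProd_apply ((by fun_prop :
        Measurable (fun p : (E d × E d) × E d => (p.1.2, p.2))) hs),
      lintegral_map (Kernel.measurable_kernel_prodMk_left hs) measurable_snd]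
    rfl

/-- Glue two almost optimal plans and apply Minkowski's inequality on the triple space. The `ε`
avoids any need for optimal plans, so the distance may be infinite. -/
theorem eW2_triangle {d : ℕ} (μ₁ μ₂ μ₃ : Measure (E d)) [IsProbabilityMeasure μ₂] :
    eW2 μ₁ μ₃ ≤ eW2 μ₁ μ₂ + eW2 μ₂ μ₃ := by
  refine ENNReal.le_of_forall_pos_le_add fun ε hε hlt => ?_
  have hε' : (ε / 2 : ℝ≥0∞) ≠ 0 := by simpa using hε.ne'
  have h12 : eW2 μ₁ μ₂ ≠ ∞ := (le_self_add.trans_lt hlt).ne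
  have h23 : eW2 μ₂ μ₃ ≠ ∞ := (le_add_self.trans_lt hlt).ne
  obtain ⟨γ, hγ, hc⟩ := exists_plan_displacement_lt (ENNReal.lt_add_right h12 hε')
  obtain ⟨γ', hγ', hc'⟩ := exists_plan_displacement_lt (ENNReal.lt_add_right h23 hε')
  obtain ⟨Γ, hΓ, hΓ'⟩ := exists_gluing hγ hγ'
  have h1 : μ₁ = Γ.map (fun p => p.1.1) := by
    rw [← hγ.1, ← hΓ, Measure.map_map measurable_fst measurable_fst]; rfl
  have h3 : μ₃ = Γ.map (fun p => p.2) := by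
    rw [← hγ'.2, ← hΓ', Measure.map_map measurable_snd (by fun_prop)]; rfl
  calc eW2 μ₁ μ₃ ≤ eLpNorm (fun p : (E d × E d) × E d => p.1.1 - p.2) 2 Γ := by
        rw [h1, h3]; exact eW2_map_map_le _ (by fun_prop) (by fun_prop)
    _ = eLpNorm ((fun p : (E d × E d) × E d => p.1.1 - p.1.2) + fun p => p.1.2 - p.2) 2 Γ := by
        congr 1; ext p : 1; simp
    _ ≤ eLpNorm (fun p : (E d × E d) × E d => p.1.1 - p.1.2) 2 Γ +
        eLpNorm (fun p : (E d × E d) × E d => p.1.2 - p.2) 2 Γ :=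
        eLpNorm_add_le (by fun_prop) (by fun_prop) (by norm_num)
    _ = displacement γ + displacement γ' := by
        rw [← hΓ, ← hΓ', displacement_map _ (by fun_prop), displacement_map _ (by fun_prop)]
    _ ≤ (eW2 μ₁ μ₂ + ε / 2) + (eW2 μ₂ μ₃ + ε / 2) := add_le_add hc.le hc'.le
    _ = eW2 μ₁ μ₂ + eW2 μ₂ μ₃ + ε := by
        rw [add_add_add_comm, ENNReal.add_halves]

theorem memLp_id_iff {d : ℕ} {μ : Measure (E d)} :
    MemLp id 2 μ ↔ ∫⁻ x, ‖x‖ₑ ^ 2 ∂μ < ∞ := by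
  have := eLpNorm_two_sq (id : E d → E d) μ
  simp only [id] at this
  rw [← this]
  constructor
  · intro h
    exact ENNReal.pow_lt_top h.2
  · intro h
    refine ⟨by fun_prop, ?_⟩
    by_contra hc
    simp only [not_lt, top_le_iff] at hc
    rw [hc] at h
    simp at h

instance {d : ℕ} (μ : P2 d) : IsProbabilityMeasure (μ : Measure (E d)) := μ.2.1

theorem P2.memLp_id {d : ℕ} (μ : P2 d) : MemLp id 2 (μ : Measure (E d)) :=
  memLp_id_iff.2 μ.2.2

theorem displacement_ne_top {d : ℕ} {μ ν : Measure (E d)} (hμ : MemLp id 2 μ)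
    (hν : MemLp id 2 ν) {γ : Measure (E d × E d)} (h : γ ∈ plans μ ν) :
    displacement γ ≠ ∞ := by
  have h1 : eLpNorm (fun p : E d × E d => p.1) 2 γ = eLpNorm id 2 μ :=
    eLpNorm_comp_fst_of_mem_plans (f := id) h hμ.1
  have h2 : eLpNorm (fun p : E d × E d => p.2) 2 γ = eLpNorm id 2 ν :=
    eLpNorm_comp_snd_of_mem_plans (f := id) h hν.1
  refine ((eLpNorm_sub_le (f := fun p : E d × E d => p.1) (g := fun p => p.2)
    (by fun_prop) (by fun_prop) (by norm_num)).trans_lt ?_).ne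
  rw [h1, h2]
  exact ENNReal.add_lt_top.2 ⟨hμ.2, hν.2⟩

theorem eW2_ne_top {d : ℕ} {μ ν : Measure (E d)} [IsProbabilityMeasure μ]
    [IsProbabilityMeasure ν] (hμ : MemLp id 2 μ) (hν : MemLp id 2 ν) : eW2 μ ν ≠ ∞ :=
  ((eW2_le_displacement (prod_mem_plans μ ν)).trans_lt
    (displacement_ne_top hμ hν (prod_mem_plans μ ν)).lt_top).ne

theorem ofReal_W2 {d : ℕ} (μ ν : P2 d) :
    ENNReal.ofReal (W2 μ ν) = eW2 (μ : Measure (E d)) (ν : Measure (E d)) :=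
  ENNReal.ofReal_toReal (eW2_ne_top μ.memLp_id ν.memLp_id)

theorem W2_nonneg {d : ℕ} (μ ν : P2 d) : 0 ≤ W2 μ ν := ENNReal.toReal_nonneg

/-! ### Nearest-point projection and Wasserstein projection. -/

/-- `pr` is the nearest point projection onto the convex set `Θ`, characterized by the
variational inequality. -/
structure IsMetricProjection {d : ℕ} (Θ : Set (E d)) (pr : E d → E d) : Prop where
  mem : ∀ x, pr x ∈ Θ
  inner_le : ∀ x, ∀ y ∈ Θ, inner ℝ (x - pr x) (y - pr x) ≤ 0

theorem exists_isMetricProjection {d : ℕ} {Θ : Set (E d)} (hclosed : IsClosed Θ)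
    (hconv : Convex ℝ Θ) (hne : Θ.Nonempty) : ∃ pr : E d → E d, IsMetricProjection Θ pr := by
  choose pr hmem hpr using exists_norm_eq_iInf_of_complete_convex hne hclosed.isComplete hconv
  exact ⟨pr, hmem, fun x => (norm_eq_iInf_iff_real_inner_le_zero hconv (hmem x)).1 (hpr x)⟩

namespace IsMetricProjection

variable {d : ℕ} {Θ : Set (E d)} {pr : E d → E d}

/-- The angle at `pr x` is obtuse. The slack against Pythagoras is what later forces uniqueness of
the Wasserstein projection. -/
theorem norm_sq_add_norm_sq_le (h : IsMetricProjection Θ pr) (x : E d) {y : E d} (hy : y ∈ Θ) :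
    ‖x - pr x‖ ^ 2 + ‖pr x - y‖ ^ 2 ≤ ‖x - y‖ ^ 2 := by
  have h1 := h.inner_le x y hy
  have h2 : x - y = (x - pr x) - (y - pr x) := by abel
  rw [h2, norm_sub_sq_real (x - pr x), norm_sub_rev (pr x) y]
  linarith

theorem apply_of_mem (h : IsMetricProjection Θ pr) {y : E d} (hy : y ∈ Θ) : pr y = y := by
  have h1 := h.norm_sq_add_norm_sq_le y hy
  simp only [sub_self, norm_zero] at h1
  have h2 : ‖pr y - y‖ ^ 2 = 0 := by nlinarith [sq_nonneg ‖y - pr y‖, sq_nonneg ‖pr y - y‖]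
  simpa [sub_eq_zero] using h2

/-- Adding the variational inequalities at `x` and `y` gives `‖pr x - pr y‖² ≤ ⟨x - y, pr x - pr
y⟩`; conclude by Cauchy–Schwarz. -/
theorem norm_sub_le (h : IsMetricProjection Θ pr) (x y : E d) :
    ‖pr x - pr y‖ ≤ ‖x - y‖ := by
  have h1 := h.inner_le x (pr y) (h.mem y)
  have h2 := h.inner_le y (pr x) (h.mem x)
  have h3 : inner ℝ (x - y) (pr x - pr y) = ‖pr x - pr y‖ ^ 2
      - inner ℝ (x - pr x) (pr y - pr x) - inner ℝ (y - pr y) (pr x - pr y) := by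
    rw [← real_inner_self_eq_norm_sq, ← neg_sub (pr x) (pr y), inner_neg_right, sub_neg_eq_add,
      ← inner_add_left, ← inner_sub_left]
    congr 1
    abel
  have h4 := real_inner_le_norm (x - y) (pr x - pr y)
  by_contra hlt
  push Not at hlt
  nlinarith [norm_nonneg (x - y), norm_nonneg (pr x - pr y)]

theorem continuous (h : IsMetricProjection Θ pr) : Continuous pr :=
  (LipschitzWith.of_dist_le_mul (K := 1) fun x y => by
    simpa [dist_eq_norm] using h.norm_sub_le x y).continuous

theorem measurable (h : IsMetricProjection Θ pr) : Measurable pr := h.continuous.measurable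

theorem memLp_comp (h : IsMetricProjection Θ pr) {Z : Type*} [MeasurableSpace Z]
    {m : Measure Z} [IsFiniteMeasure m] {f : Z → E d} (hf : MemLp f 2 m) :
    MemLp (fun z => pr (f z)) 2 m := by
  have hb : MemLp (fun z => ‖f z‖ + ‖pr 0‖) 2 m := hf.norm.add (memLp_const _)
  refine hb.mono (h.continuous.comp_aestronglyMeasurable hf.1) (ae_of_all _ fun z => ?_)
  have h1 := h.norm_sub_le (f z) 0
  have h2 := norm_add_le (pr (f z) - pr 0) (pr 0)
  rw [sub_add_cancel] at h2
  rw [sub_zero] at h1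
  rw [Real.norm_of_nonneg (by positivity)]
  linarith

end IsMetricProjection

theorem support_subset_iff_ae_mem {d : ℕ} {Θ : Set (E d)} (hΘ : IsClosed Θ) {μ : Measure (E d)} :
    μ.support ⊆ Θ ↔ ∀ᵐ x ∂μ, x ∈ Θ :=
  ⟨fun h => mem_of_superset Measure.support_mem_ae h, Measure.support_subset_of_isClosed hΘ⟩

theorem memLp_id_map {d : ℕ} {Z : Type*} [MeasurableSpace Z] {m : Measure Z} {f : Z → E d}
    (hf : MemLp f 2 m) (hmeas : Measurable f) : MemLp id 2 (m.map f) := by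
  rw [memLp_map_measure_iff (by fun_prop) hmeas.aemeasurable]
  exact hf

/-- The law of a square integrable map, as an element of `P2 d`. -/
noncomputable def P2.ofMap {d : ℕ} {Z : Type*} [MeasurableSpace Z] (m : Measure Z)
    [IsProbabilityMeasure m] (f : Z → E d) (hmeas : Measurable f) (hf : MemLp f 2 m) : P2 d :=
  ⟨m.map f, Measure.isProbabilityMeasure_map hmeas.aemeasurable,
    memLp_id_iff.1 (memLp_id_map hf hmeas)⟩

/-- The Wasserstein projection onto the measures supported in a closed convex set is the image
under the nearest point projection. -/
theorem IsWassersteinProjection.eq_map {d : ℕ} {Θ : Set (E d)} (hΘ : IsClosed Θ) {pr : E d → E d}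
    (hpr : IsMetricProjection Θ pr)
    (hopt : ∀ μ ν : P2 d, (optimalPlans (μ : Measure (E d)) (ν : Measure (E d))).Nonempty)
    {ν : Measure (E d)} [IsProbabilityMeasure ν] (hν : MemLp id 2 ν) {μ : P2 d}
    (h : IsWassersteinProjection Θ ν μ) : (μ : Measure (E d)) = ν.map pr := by
  have hprLp : MemLp pr 2 ν := hpr.memLp_comp (f := id) hν
  set ν' : P2 d := P2.ofMap ν pr hpr.measurable hprLp with hν'
  have hcoe : (ν' : Measure (E d)) = ν.map pr := rfl
  set ν₀ : P2 d := ⟨ν, inferInstance, memLp_id_iff.1 hν⟩ with hν₀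
  have hsupp : (ν' : Measure (E d)).support ⊆ Θ := by
    rw [support_subset_iff_ae_mem hΘ, hcoe,
      ae_map_iff (p := (· ∈ Θ)) hpr.measurable.aemeasurable hΘ.measurableSet]
    exact ae_of_all _ hpr.mem
  set D := eLpNorm (fun x => x - pr x) 2 ν with hD
  have hDtop : D ≠ ∞ := (MemLp.sub (f := fun x : E d => x) hν hprLp).2.ne
  have hle : eW2 ν μ ≤ D := by
    refine (h.2 ν' hsupp).trans ?_
    have := eW2_map_map_le ν measurable_id hpr.measurable
    rwa [Measure.map_id] at this
  obtain ⟨γ, hγ⟩ := hopt ν₀ μ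
  have hγΘ : ∀ᵐ p ∂γ, p.2 ∈ Θ := by
    have hm := (support_subset_iff_ae_mem hΘ).1 h.1
    rw [← hγ.1.2, ae_map_iff (p := (· ∈ Θ)) (by fun_prop) hΘ.measurableSet] at hm
    exact hm
  have hprm := hpr.measurable
  -- Pythagoras integrated along an optimal plan. Since `ν.map pr` is a competitor, the right side
  -- is at most `D ^ 2`, and `D` is finite, so the extra term vanishes and `γ` sits on the graph of
  -- `pr`.
  have hsq : D ^ 2 + eLpNorm (fun p : E d × E d => pr p.1 - p.2) 2 γ ^ 2 ≤ eW2 ν μ ^ 2 := by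
    rw [eW2_eq_displacement hγ, displacement, hD,
      ← eLpNorm_comp_fst_of_mem_plans hγ.1 (f := fun x => x - pr x)
        (by fun_prop), eLpNorm_two_sq, eLpNorm_two_sq, eLpNorm_two_sq,
      ← lintegral_add_left (by fun_prop)]
    refine lintegral_mono_ae ?_
    filter_upwards [hγΘ] with p hp
    have := hpr.norm_sq_add_norm_sq_le p.1 hp
    rw [← ofReal_norm, ← ofReal_norm, ← ofReal_norm,
      ← ENNReal.ofReal_pow (norm_nonneg _), ← ENNReal.ofReal_pow (norm_nonneg _),
      ← ENNReal.ofReal_pow (norm_nonneg _), ← ENNReal.ofReal_add (by positivity) (by positivity)]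
    exact ENNReal.ofReal_le_ofReal this
  have hzero : eLpNorm (fun p : E d × E d => pr p.1 - p.2) 2 γ ^ 2 = 0 := by
    have h1 : D ^ 2 + eLpNorm (fun p : E d × E d => pr p.1 - p.2) 2 γ ^ 2 ≤ D ^ 2 + 0 := by
      rw [add_zero]
      exact hsq.trans (by gcongr)
    exact nonpos_iff_eq_zero.1 ((ENNReal.add_le_add_iff_left (ENNReal.pow_ne_top hDtop)).1 h1)
  rw [pow_eq_zero_iff (by norm_num), eLpNorm_eq_zero_iff (by fun_prop) (by norm_num)] at hzero
  rw [← hγ.1.2, show ν = γ.map Prod.fst from hγ.1.1.symm, Measure.map_map hprm measurable_fst]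
  refine Measure.map_congr ?_
  filter_upwards [hzero] with p hp
  simpa [sub_eq_zero, eq_comm] using hp

/-! ### Geodesic convexity and the first-order inequality. -/

theorem GeodesicallyConvex.optimalPlans_nonempty {d : ℕ} {α : ℝ} {J : P2 d → ℝ}
    (hJ : GeodesicallyConvex α J) (μ ν : P2 d) :
    (optimalPlans (μ : Measure (E d)) (ν : Measure (E d))).Nonempty := by
  obtain ⟨_, ⟨γ, hγ, _⟩, _⟩ := hJ μ ν
  exact ⟨γ, hγ⟩

/-- Restricting an optimal plan to the initial part of its displacement interpolation gives an
optimal plan. -/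
theorem optimalPlans_initial_segment {d : ℕ} {μ ν : P2 d} {γ : Measure (E d × E d)}
    (hγ : γ ∈ optimalPlans (μ : Measure (E d)) (ν : Measure (E d))) {t : ℝ}
    (ht : t ∈ Set.Icc (0 : ℝ) 1) {ρ : P2 d}
    (hρ : (ρ : Measure (E d)) = γ.map (fun p => (1 - t) • p.1 + t • p.2)) :
    γ.map (fun p => (p.1, (1 - t) • p.1 + t • p.2)) ∈
      optimalPlans (μ : Measure (E d)) (ρ : Measure (E d)) ∧ W2 μ ρ = t * W2 μ ν := by
  have hmem : γ.map (fun p => (p.1, (1 - t) • p.1 + t • p.2)) ∈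
      plans (μ : Measure (E d)) (ρ : Measure (E d)) := by
    have := map_prodMk_mem_plans γ (f := Prod.fst) (g := fun p => (1 - t) • p.1 + t • p.2)
      measurable_fst (by fun_prop)
    rwa [hγ.1.1, ← hρ] at this
  have hdisp : displacement (γ.map (fun p => (p.1, (1 - t) • p.1 + t • p.2))) =
      ENNReal.ofReal t * eW2 (μ : Measure (E d)) (ν : Measure (E d)) := by
    rw [displacement_map _ (by fun_prop), eW2_eq_displacement hγ, displacement]
    have : (fun z : E d × E d => z.1 - ((1 - t) • z.1 + t • z.2)) =
        t • fun z : E d × E d => z.1 - z.2 := by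
      ext1 z
      simp only [Pi.smul_apply]
      module
    simp only [this, eLpNorm_const_smul]
    congr 1
    rw [← ofReal_norm, Real.norm_of_nonneg ht.1]
  have hend : eW2 (ρ : Measure (E d)) (ν : Measure (E d)) ≤
      ENNReal.ofReal (1 - t) * eW2 (μ : Measure (E d)) (ν : Measure (E d)) := by
    rw [hρ]
    nth_rw 1 [← hγ.1.2]
    refine (eW2_map_map_le γ (by fun_prop) measurable_snd).trans_eq ?_
    rw [eW2_eq_displacement hγ, displacement]
    have : (fun z : E d × E d => ((1 - t) • z.1 + t • z.2) - z.2) =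
        (1 - t) • fun z : E d × E d => z.1 - z.2 := by
      ext1 z
      simp only [Pi.smul_apply]
      module
    simp only [this, eLpNorm_const_smul]
    congr 1
    rw [← ofReal_norm, Real.norm_of_nonneg (by linarith [ht.2])]
  -- The remaining segment costs at most `(1 - t) W2 μ ν`, so by the triangle inequality the initial
  -- one cannot cost less than `t W2 μ ν`.
  have hge : ENNReal.ofReal t * eW2 (μ : Measure (E d)) (ν : Measure (E d)) ≤
      eW2 (μ : Measure (E d)) (ρ : Measure (E d)) := by
    have htri := eW2_triangle (μ : Measure (E d)) (ρ : Measure (E d)) (ν : Measure (E d))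
    rw [← ofReal_W2, ← ofReal_W2, ← ENNReal.ofReal_mul ht.1]
    rw [← ofReal_W2, ← ofReal_W2, ← ENNReal.ofReal_mul (by linarith [ht.2]),
      ENNReal.ofReal_le_ofReal_iff (mul_nonneg (by linarith [ht.2]) (W2_nonneg _ _))] at hend
    rw [← ofReal_W2, ← ofReal_W2, ← ofReal_W2, ← ENNReal.ofReal_add (W2_nonneg _ _)
      (W2_nonneg _ _), ENNReal.ofReal_le_ofReal_iff (add_nonneg (W2_nonneg _ _)
      (W2_nonneg _ _))] at htri
    apply ENNReal.ofReal_le_ofReal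
    linarith
  have hopt := mem_optimalPlans_of_displacement_le hmem (hdisp.trans_le hge)
  refine ⟨hopt, ?_⟩
  rw [W2, eW2_eq_displacement hopt, hdisp, ENNReal.toReal_mul, ENNReal.toReal_ofReal ht.1, W2]

/-- Along the geodesic, compare the convexity upper bound for `J (m t) - J μ` with the lower bound
from differentiability, divide by `t` and let `t` be small. Differentiability applies because the
plan from `μ` to `m t` induced by `γ` is again optimal. The resulting inequality holds for the plan
that carries the convex geodesic, hence the existential. -/
theorem exists_optimalPlan_gradient_inequality {d : ℕ} {α : ℝ} {J : P2 d → ℝ} {μ : P2 d}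
    {g : E d → E d} (hg : IsWassersteinGradient J μ g) (hα : 0 < α)
    (hJ : GeodesicallyConvex α J) (ν : P2 d) :
    ∃ γ ∈ optimalPlans (μ : Measure (E d)) (ν : Measure (E d)),
      J μ + ∫ p, inner ℝ (g p.1) (p.2 - p.1) ∂γ + α / 2 * W2 μ ν ^ 2 ≤ J ν := by
  obtain ⟨m, ⟨γ, hγ, hm⟩, hconv⟩ := hJ μ ν
  refine ⟨γ, hγ, le_of_forall_pos_le_add fun η hη => ?_⟩
  set I := ∫ p, inner ℝ (g p.1) (p.2 - p.1) ∂γ with hI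
  set W := W2 μ ν with hW
  have hW0 : 0 ≤ W := W2_nonneg _ _
  -- The error `η` is split in half between the differentiability remainder and the term `α / 2 * t
  -- * W ^ 2`. The three bounds on `t` below keep it in the unit interval, within radius `δ`, and
  -- small enough for the second half; the `+ 1` covers `W = 0`.
  obtain ⟨δ, hδ, hdiff⟩ := hg.2 (η / (2 * (W + 1))) (by positivity)
  set t := min 1 (min (δ / (2 * (W + 1))) (η / (2 * (α / 2 * W ^ 2 + 1)))) with ht
  have ht0 : 0 < t := by positivity
  have htI : t ∈ Set.Icc (0 : ℝ) 1 := ⟨ht0.le, min_le_left _ _⟩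
  obtain ⟨hγt, hWt⟩ := optimalPlans_initial_segment hγ htI (hm t htI)
  have htW : t * W < δ := by
    have h1 : t ≤ δ / (2 * (W + 1)) := (min_le_right _ _).trans (min_le_left _ _)
    rw [le_div_iff₀ (by positivity)] at h1
    nlinarith
  have htα : t * (α / 2 * W ^ 2) ≤ η / 2 := by
    have h1 : t ≤ η / (2 * (α / 2 * W ^ 2 + 1)) := (min_le_right _ _).trans (min_le_right _ _)
    rw [le_div_iff₀ (by positivity)] at h1
    nlinarith
  have h1 := hdiff (m t) (by rw [hWt]; exact htW) _ hγt
  have hgm : AEStronglyMeasurable g (γ.map Prod.fst) := by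
    rw [hγ.1.1]; exact hg.1.1
  have hint : ∫ p, inner ℝ (g p.1) (p.2 - p.1)
      ∂(γ.map (fun p => (p.1, (1 - t) • p.1 + t • p.2))) = t * I := by
    rw [integral_map (by fun_prop), hI, ← integral_const_mul]
    · congr 1
      ext1 p
      rw [← real_inner_smul_right]
      congr 1
      module
    · refine AEStronglyMeasurable.inner ?_ (by fun_prop)
      refine AEStronglyMeasurable.comp_measurable ?_ measurable_fst
      rw [Measure.map_map (by fun_prop) (by fun_prop)]
      exact hgm
  rw [hint, hWt] at h1
  have h2 := hconv t htI
  have h3 := (abs_le.1 h1).1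
  have h4 : η / (2 * (W + 1)) * W ≤ η / 2 := by
    rw [div_mul_eq_mul_div, div_le_div_iff₀ (by positivity) (by norm_num)]
    nlinarith
  have h5 : t * (J μ + I + α / 2 * W ^ 2 - J ν) ≤ t * η := by
    nlinarith
  linarith [le_of_mul_le_mul_left h5 ht0]

/-! ### Measurability of the Wasserstein distance to a fixed measure. -/

theorem ennreal_tendsto_of_le_add {u e : ℕ → ℝ≥0∞} {a : ℝ≥0∞} (he : Tendsto e atTop (𝓝 0))
    (h₁ : ∀ n, u n ≤ e n + a) (h₂ : ∀ n, a ≤ e n + u n) : Tendsto u atTop (𝓝 a) := by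
  have hl : Tendsto (fun n => a - e n) atTop (𝓝 a) := by
    simpa using ENNReal.Tendsto.sub (tendsto_const_nhds (x := a)) he (Or.inr ENNReal.zero_ne_top)
  have hr : Tendsto (fun n => e n + a) atTop (𝓝 a) := by
    simpa using he.add (tendsto_const_nhds (x := a))
  exact tendsto_of_tendsto_of_tendsto_of_le_of_le hl hr (fun n => tsub_le_iff_left.2 (h₂ n)) h₁

theorem tendsto_eW2_of_tendsto {d : ℕ} {μ ν : Measure (E d)} [IsProbabilityMeasure μ]
    {ρ : ℕ → Measure (E d)} (hρ : ∀ n, IsProbabilityMeasure (ρ n)) {e : ℕ → ℝ≥0∞}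
    (he : Tendsto e atTop (𝓝 0)) (hle : ∀ n, eW2 μ (ρ n) ≤ e n) :
    Tendsto (fun n => eW2 (ρ n) ν) atTop (𝓝 (eW2 μ ν)) := by
  refine ennreal_tendsto_of_le_add he (fun n => ?_) (fun n => ?_)
  · refine (eW2_triangle (ρ n) μ ν).trans ?_
    rw [eW2_comm (ρ n) μ]
    gcongr
    exact hle n
  · refine (eW2_triangle μ (ρ n) ν).trans ?_
    gcongr
    exact hle n

/-- The measure with atoms of mass `v x` at the points `x ∈ F`, completed at the origin to total
mass one. -/
noncomputable def atomicMeasure {d : ℕ} (F : Finset (E d)) (v : F → ℝ≥0∞) : Measure (E d) :=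
  (∑ x : F, v x • Measure.dirac (x : E d)) + (1 - ∑ x : F, v x) • Measure.dirac 0

theorem measure_finset_sum_apply {Z ι : Type*} [MeasurableSpace Z] (s : Finset ι)
    (m : ι → Measure Z) (A : Set Z) : (∑ i ∈ s, m i) A = ∑ i ∈ s, m i A := by
  simp

theorem map_finset_sum {Z Y ι : Type*} [MeasurableSpace Z] [MeasurableSpace Y] (s : Finset ι)
    (m : ι → Measure Z) {f : Z → Y} (hf : Measurable f) :
    (∑ i ∈ s, m i).map f = ∑ i ∈ s, (m i).map f := by
  ext A hA
  rw [Measure.map_apply hf hA, measure_finset_sum_apply, measure_finset_sum_apply]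
  exact Finset.sum_congr rfl fun i _ => (Measure.map_apply hf hA).symm

/-- Leave mass `v x` in place at each atom and send the surplus `w x - v x` to the origin. -/
theorem eW2_atomicMeasure_sq_le {d : ℕ} (F : Finset (E d)) {v w : F → ℝ≥0∞} (hvw : v ≤ w)
    (hw : ∑ x : F, w x = 1) :
    eW2 (∑ x : F, w x • Measure.dirac (x : E d)) (atomicMeasure F v) ^ 2 ≤
      ∑ x : F, (w x - v x) * ‖(x : E d)‖ₑ ^ 2 := by
  set γ : Measure (E d × E d) := (∑ x : F, v x • Measure.dirac ((x : E d), (x : E d))) +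
    ∑ x : F, (w x - v x) • Measure.dirac ((x : E d), (0 : E d)) with hγ
  have hfst : γ.map Prod.fst = ∑ x : F, w x • Measure.dirac (x : E d) := by
    rw [hγ, Measure.map_add _ _ measurable_fst, map_finset_sum _ _ measurable_fst,
      map_finset_sum _ _ measurable_fst, ← Finset.sum_add_distrib]
    refine Finset.sum_congr rfl fun x _ => ?_
    rw [Measure.map_smul, Measure.map_smul, Measure.map_dirac' measurable_fst,
      Measure.map_dirac' measurable_fst, ← add_smul, add_tsub_cancel_of_le (hvw x)]
  have hsnd : γ.map Prod.snd = atomicMeasure F v := by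
    rw [hγ, Measure.map_add _ _ measurable_snd, map_finset_sum _ _ measurable_snd,
      map_finset_sum _ _ measurable_snd, atomicMeasure]
    congr 1
    · refine Finset.sum_congr rfl fun x _ => ?_
      rw [Measure.map_smul, Measure.map_dirac' measurable_snd]
    · have hs : ∑ x : F, (w x - v x) = 1 - ∑ x : F, v x := by
        have hle : ∑ x : F, v x ≤ 1 := hw ▸ Finset.sum_le_sum fun x _ => hvw x
        refine ENNReal.eq_sub_of_add_eq (hle.trans_lt ENNReal.one_lt_top).ne ?_
        rw [← Finset.sum_add_distrib, ← hw]
        exact Finset.sum_congr rfl fun x _ => tsub_add_cancel_of_le (hvw x)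
      rw [← hs, Finset.sum_smul]
      refine Finset.sum_congr rfl fun x _ => ?_
      rw [Measure.map_smul, Measure.map_dirac' measurable_snd]
  refine (pow_le_pow_left₀ zero_le (eW2_le_displacement ⟨hfst, hsnd⟩) 2).trans ?_
  rw [displacement_sq, cost, hγ, lintegral_add_measure, lintegral_finsetSum_measure,
    lintegral_finsetSum_measure]
  simp [lintegral_smul_measure]

theorem isProbabilityMeasure_atomicMeasure {d : ℕ} (F : Finset (E d)) {v : F → ℝ≥0∞}
    (hv : ∑ x : F, v x ≤ 1) : IsProbabilityMeasure (atomicMeasure F v) := by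
  refine ⟨?_⟩
  simp only [atomicMeasure, Measure.add_apply, measure_finset_sum_apply, Measure.smul_apply,
    measure_univ, smul_eq_mul, mul_one]
  exact add_tsub_cancel_of_le hv

theorem map_simpleFunc_eq_sum {d : ℕ} (μ : Measure (E d)) (s : SimpleFunc (E d) (E d)) :
    μ.map s = ∑ x : s.range, μ (s ⁻¹' {(x : E d)}) • Measure.dirac (x : E d) := by
  ext A hA
  rw [Measure.map_apply s.measurable hA, measure_finset_sum_apply]
  simp only [Measure.smul_apply, Measure.dirac_apply' _ hA, smul_eq_mul]
  rw [Finset.sum_coe_sort s.range (fun x => μ (s ⁻¹' {x}) * A.indicator 1 x)]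
  classical
  have : s ⁻¹' A = s ⁻¹' (s.range.filter (· ∈ A) : Finset (E d)) := by
    ext z; simp
  rw [this, ← SimpleFunc.sum_measure_preimage_singleton, Finset.sum_filter]
  refine Finset.sum_congr rfl fun x _ => ?_
  by_cases hx : x ∈ A <;> simp [hx]

/-- Any function of finitely many simple functions is measurable. -/
theorem SimpleFunc.measurable_comp_pi {Ω ι X Y Z : Type*} [Finite ι] [MeasurableSpace Ω]
    [MeasurableSpace X] [MeasurableSpace Z] (a : SimpleFunc X Y) {w : Ω → ι → X}
    (hw : ∀ i, Measurable (fun ω => w ω i)) (G : (ι → Y) → Z) :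
    Measurable (fun ω => G (fun i => a (w ω i))) := by
  -- A simple function is measurable even for the discrete σ-algebra on its codomain, and tuples
  -- with entries in its finite range form a discrete space.
  let _ : MeasurableSpace Y := ⊤
  have hcode : Measurable (fun ω => fun i =>
      (⟨a (w ω i), SimpleFunc.mem_range_self _ _⟩ : a.range)) :=
    measurable_pi_lambda _ fun i => Measurable.subtype_mk (a.measurable.comp (hw i))
  exact (Measurable.of_discrete (f := fun v : ι → a.range => G (fun i => (v i : Y)))).comp hcode

/-- The distance is an infimum over uncountably many plans, so measurability is not immediate.
Rounding the weights down to finitely many values makes it trivially measurable; the lost mass is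
placed at the origin and its cost tends to zero. -/
theorem measurable_eW2_sum_dirac {d : ℕ} {Ω : Type*} [MeasurableSpace Ω] (F : Finset (E d))
    {w : Ω → F → ℝ≥0∞} (hw : ∀ x, Measurable (fun ω => w ω x)) (hsum : ∀ ω, ∑ x, w ω x = 1)
    (ν : Measure (E d)) :
    Measurable (fun ω => eW2 (∑ x : F, w ω x • Measure.dirac (x : E d)) ν) := by
  set a : ℕ → SimpleFunc ℝ≥0∞ ℝ≥0∞ := SimpleFunc.eapprox id with ha
  have hale : ∀ n r, a n r ≤ r := fun n r =>
    (le_iSup (fun k => a k r) n).trans_eq (SimpleFunc.iSup_eapprox_apply measurable_id r)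
  have hat : ∀ r, Tendsto (fun n => a n r) atTop (𝓝 r) := fun r =>
    SimpleFunc.tendsto_eapprox measurable_id r
  have hv : ∀ n ω, ∑ x, a n (w ω x) ≤ 1 := fun n ω =>
    (Finset.sum_le_sum fun x _ => hale n _).trans_eq (hsum ω)
  refine measurable_of_tendsto_metrizable
    (f := fun n ω => eW2 (atomicMeasure F fun x => a n (w ω x)) ν)
    (fun n => SimpleFunc.measurable_comp_pi (a n) hw fun v => eW2 (atomicMeasure F v) ν) ?_
  refine tendsto_pi_nhds.2 fun ω => ?_
  have hp : IsProbabilityMeasure (∑ x : F, w ω x • Measure.dirac (x : E d)) := by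
    refine ⟨?_⟩
    rw [measure_finset_sum_apply]
    simpa using hsum ω
  refine tendsto_eW2_of_tendsto
    (fun n => isProbabilityMeasure_atomicMeasure _ (hv n ω))
    (e := fun n => (∑ x : F, (w ω x - a n (w ω x)) * ‖(x : E d)‖ₑ ^ 2) ^ (1 / 2 : ℝ)) ?_
    (fun n => ?_)
  · have hlim : Tendsto (fun n => ∑ x : F, (w ω x - a n (w ω x)) * ‖(x : E d)‖ₑ ^ 2)
        atTop (𝓝 (∑ x : F, 0 * ‖(x : E d)‖ₑ ^ 2)) := by
      refine tendsto_finsetSum _ fun x _ => ?_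
      refine ENNReal.Tendsto.mul_const ?_ (Or.inr (by finiteness))
      have hwt : w ω x ≠ ∞ := by
        refine ((Finset.single_le_sum (f := w ω) (fun i _ => zero_le)
          (Finset.mem_univ x)).trans_lt ?_).ne
        rw [hsum ω]
        exact ENNReal.one_lt_top
      simpa using ENNReal.Tendsto.sub (tendsto_const_nhds (x := w ω x)) (hat (w ω x))
        (Or.inl hwt)
    have := hlim.ennrpow_const (1 / 2)
    simpa using this
  · rw [← ENNReal.pow_le_pow_left_iff (n := 2) (by norm_num), ← ENNReal.rpow_natCast (_ ^ _),
      ← ENNReal.rpow_mul]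
    norm_num
    exact eW2_atomicMeasure_sq_le _ (fun x => hale n _) (hsum ω)

theorem measurable_eW2_map_simpleFunc {d : ℕ} {Ω : Type*} [MeasurableSpace Ω]
    {K : Ω → Measure (E d)} (hK : Measurable K) (hprob : ∀ ω, IsProbabilityMeasure (K ω))
    (ν : Measure (E d)) (s : SimpleFunc (E d) (E d)) :
    Measurable (fun ω => eW2 ((K ω).map s) ν) := by
  simp_rw [map_simpleFunc_eq_sum]
  refine measurable_eW2_sum_dirac _ (fun x =>
    (Measure.measurable_coe (s.measurableSet_preimage _)).comp hK) (fun ω => ?_) ν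
  have := hprob ω
  have hp : IsProbabilityMeasure ((K ω).map s) :=
    Measure.isProbabilityMeasure_map s.measurable.aemeasurable
  have := measure_univ (μ := (K ω).map s)
  rw [map_simpleFunc_eq_sum, measure_finset_sum_apply] at this
  simpa using this

/-- Push `K ω` forward by simple functions converging to the identity in `L²(K ω)`. The distances
converge wherever `K ω` has a finite second moment, and each approximation is finitely supported. -/
theorem aemeasurable_eW2 {d : ℕ} {Ω : Type*} [MeasurableSpace Ω] {P : Measure Ω}
    {K : Ω → Measure (E d)} (hK : Measurable K) (hprob : ∀ ω, IsProbabilityMeasure (K ω))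
    (hLp : ∀ᵐ ω ∂P, MemLp id 2 (K ω)) (ν : Measure (E d)) :
    AEMeasurable (fun ω => eW2 (K ω) ν) P := by
  set s : ℕ → SimpleFunc (E d) (E d) :=
    SimpleFunc.approxOn id measurable_id Set.univ 0 (Set.mem_univ _) with hs
  refine aemeasurable_of_tendsto_metrizable_ae atTop
    (f := fun n ω => eW2 ((K ω).map (s n)) ν)
    (fun n => (measurable_eW2_map_simpleFunc hK hprob ν (s n)).aemeasurable) ?_
  filter_upwards [hLp] with ω hω
  have := hprob ω
  refine tendsto_eW2_of_tendsto
    (fun n => Measure.isProbabilityMeasure_map (s n).measurable.aemeasurable)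
    (SimpleFunc.tendsto_approxOn_Lp_eLpNorm (μ := K ω) (p := 2) measurable_id (Set.mem_univ 0)
      (by norm_num) (by simp) (by simpa only [sub_zero] using hω.2)) (fun n => ?_)
  have h1 := eW2_map_map_le (K ω) measurable_id (s n).measurable
  rw [Measure.map_id] at h1
  refine h1.trans_eq ?_
  rw [← eLpNorm_neg]
  congr 1
  ext1 x
  simp [hs]

/-! ### Matrix square roots and the Bures distance. -/

section Matrices

variable {d : ℕ}

section

open scoped Matrix.Norms.L2Operator

/-- The operator norm serves only to provide a C⋆-algebra structure; the statement concerns the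
usual matrix topology. -/
theorem continuousOn_matrix_sqrt :
    ContinuousOn (CFC.sqrt : Matrix (Fin d) (Fin d) ℝ → Matrix (Fin d) (Fin d) ℝ) {A | 0 ≤ A} :=
  CFC.continuousOn_sqrt (A := Matrix (Fin d) (Fin d) ℝ)

end

theorem posDef_sqrt {A : Matrix (Fin d) (Fin d) ℝ} (hA : A.PosDef) : (CFC.sqrt A).PosDef :=
  Matrix.isStrictlyPositive_iff_posDef.1
    (IsStrictlyPositive.sqrt A (Matrix.isStrictlyPositive_iff_posDef.2 hA))

theorem transpose_sqrt (A : Matrix (Fin d) (Fin d) ℝ) : (CFC.sqrt A).transpose = CFC.sqrt A := by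
  have := (Matrix.nonneg_iff_posSemidef.1 (CFC.sqrt_nonneg A)).isHermitian.eq
  rwa [Matrix.conjTranspose_eq_transpose_of_trivial] at this

theorem sqrt_mul_mul_sqrt_nonneg (A : Matrix (Fin d) (Fin d) ℝ) {B : Matrix (Fin d) (Fin d) ℝ}
    (hB : B.PosSemidef) : (CFC.sqrt A * B * CFC.sqrt A).PosSemidef := by
  have := hB.conjTranspose_mul_mul_same (CFC.sqrt A)
  rwa [Matrix.conjTranspose_eq_transpose_of_trivial, transpose_sqrt] at this

/-- The block matrix with diagonal blocks `A`, `B` and off-diagonal block `-C` is nonnegative. -/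
def BlockNonneg (A B C : Matrix (Fin d) (Fin d) ℝ) : Prop :=
  ∀ u v : Fin d → ℝ, 0 ≤ u ⬝ᵥ A.mulVec u + v ⬝ᵥ B.mulVec v - 2 * (u ⬝ᵥ C.mulVec v)

theorem trace_transpose_mul_mul (U V A : Matrix (Fin d) (Fin d) ℝ) :
    (U.transpose * A * V).trace = ∑ j, (U.col j) ⬝ᵥ A.mulVec (V.col j) := by
  refine Finset.sum_congr rfl fun j _ => ?_
  rw [Matrix.diag_apply, Matrix.mul_assoc, Matrix.mul_apply]
  refine Finset.sum_congr rfl fun i _ => ?_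
  simp [Matrix.mul_apply, Matrix.mulVec, dotProduct, Matrix.col]

theorem BlockNonneg.trace_nonneg {A B C : Matrix (Fin d) (Fin d) ℝ} (h : BlockNonneg A B C)
    (U V : Matrix (Fin d) (Fin d) ℝ) :
    0 ≤ (U.transpose * A * U).trace + (V.transpose * B * V).trace
      - 2 * (U.transpose * C * V).trace := by
  rw [trace_transpose_mul_mul, trace_transpose_mul_mul, trace_transpose_mul_mul, Finset.mul_sum,
    ← Finset.sum_add_distrib, ← Finset.sum_sub_distrib]
  exact Finset.sum_nonneg fun j _ => h _ _

/-- Write `R = A^{1/2}` and `N = (R B R)^{1/2}`. Testing the block form on the columns of `R⁻¹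
N^{1/2}` and `R N^{-1/2}` makes both diagonal terms `tr N`, while the cross term is `tr C` by
cyclicity. Hence `2 tr N - 2 tr C ≥ 0`. -/
theorem BlockNonneg.trace_le_of_posDef {A B C : Matrix (Fin d) (Fin d) ℝ} (h : BlockNonneg A B C)
    (hA : A.PosDef) (hB : B.PosDef) :
    C.trace ≤ (CFC.sqrt (CFC.sqrt A * B * CFC.sqrt A)).trace := by
  set R := CFC.sqrt A with hR
  have hRu : IsUnit R := (posDef_sqrt hA).isUnit
  have hRdet : IsUnit R.det := (Matrix.isUnit_iff_isUnit_det _).1 hRu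
  have hRR : R * R = A := CFC.sqrt_mul_sqrt_self A (Matrix.nonneg_iff_posSemidef.2 hA.posSemidef)
  have hRt : R.transpose = R := transpose_sqrt A
  have hQ : (R * B * R).PosDef := by
    refine (sqrt_mul_mul_sqrt_nonneg A hB.posSemidef).posDef_iff_isUnit.2 ?_
    exact (hRu.mul hB.isUnit).mul hRu
  set N := CFC.sqrt (R * B * R) with hN
  have hNN : N * N = R * B * R :=
    CFC.sqrt_mul_sqrt_self _ (Matrix.nonneg_iff_posSemidef.2 hQ.posSemidef)
  have hNpd : N.PosDef := posDef_sqrt hQ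
  set S := CFC.sqrt N with hS
  have hSS : S * S = N :=
    CFC.sqrt_mul_sqrt_self _ (Matrix.nonneg_iff_posSemidef.2 hNpd.posSemidef)
  have hSdet : IsUnit S.det := (Matrix.isUnit_iff_isUnit_det _).1 (posDef_sqrt hNpd).isUnit
  have hSt : S.transpose = S := transpose_sqrt N
  have key := h.trace_nonneg (R⁻¹ * S) (R * S⁻¹)
  have h1 : ((R⁻¹ * S).transpose * A * (R⁻¹ * S)).trace = N.trace := by
    rw [Matrix.transpose_mul, Matrix.transpose_nonsing_inv, hRt, hSt, ← hRR]
    calc (S * R⁻¹ * (R * R) * (R⁻¹ * S)).trace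
        = (S * (R⁻¹ * R) * (R * R⁻¹) * S).trace := by simp only [Matrix.mul_assoc]
      _ = N.trace := by
        rw [Matrix.nonsing_inv_mul _ hRdet, Matrix.mul_nonsing_inv _ hRdet, mul_one, mul_one, hSS]
  have h2 : ((R * S⁻¹).transpose * B * (R * S⁻¹)).trace = N.trace := by
    rw [Matrix.transpose_mul, Matrix.transpose_nonsing_inv, hRt, hSt]
    calc (S⁻¹ * R * B * (R * S⁻¹)).trace
        = (S⁻¹ * (R * B * R) * S⁻¹).trace := by simp only [Matrix.mul_assoc]
      _ = ((S⁻¹ * S) * (S * S) * (S * S⁻¹)).trace := by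
        rw [← hNN, ← hSS]; simp only [Matrix.mul_assoc]
      _ = N.trace := by
        rw [Matrix.nonsing_inv_mul _ hSdet, Matrix.mul_nonsing_inv _ hSdet, mul_one, one_mul, hSS]
  have h3 : ((R⁻¹ * S).transpose * C * (R * S⁻¹)).trace = C.trace := by
    rw [Matrix.transpose_mul, Matrix.transpose_nonsing_inv, hRt, hSt, ← Matrix.mul_assoc,
      Matrix.trace_mul_comm]
    calc (S⁻¹ * (S * R⁻¹ * C * R)).trace = ((S⁻¹ * S) * (R⁻¹ * C * R)).trace := by
          simp only [Matrix.mul_assoc]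
      _ = C.trace := by
        rw [Matrix.nonsing_inv_mul _ hSdet, one_mul, Matrix.trace_mul_comm, ← Matrix.mul_assoc,
          Matrix.mul_nonsing_inv _ hRdet, one_mul]
  rw [h1, h2, h3] at key
  linarith

theorem dotProduct_add_smul_one_mulVec (A : Matrix (Fin d) (Fin d) ℝ) (ε : ℝ) (u : Fin d → ℝ) :
    u ⬝ᵥ (A + ε • (1 : Matrix (Fin d) (Fin d) ℝ)).mulVec u = u ⬝ᵥ A.mulVec u + ε * (u ⬝ᵥ u) := by
  rw [Matrix.add_mulVec, Matrix.smul_mulVec, Matrix.one_mulVec, dotProduct_add, dotProduct_smul,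
    smul_eq_mul]

/-- Adding `ε` times the identity to `A` and `B` preserves block nonnegativity and gives
definiteness; then `ε → 0` by continuity of the square root on the nonnegative cone. -/
theorem BlockNonneg.trace_le {A B C : Matrix (Fin d) (Fin d) ℝ} (h : BlockNonneg A B C)
    (hA : A.PosSemidef) (hB : B.PosSemidef) :
    C.trace ≤ (CFC.sqrt (CFC.sqrt A * B * CFC.sqrt A)).trace := by
  have hpd : ∀ ε : ℝ, 0 < ε → (ε • (1 : Matrix (Fin d) (Fin d) ℝ)).PosDef := fun ε hε =>
    Matrix.PosDef.one.smul hε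
  have hcont : ∀ M : Matrix (Fin d) (Fin d) ℝ,
      Tendsto (fun ε : ℝ => M + ε • (1 : Matrix (Fin d) (Fin d) ℝ)) (𝓝[>] 0) (𝓝 M) := fun M => by
    have hc : Continuous (fun ε : ℝ => M + ε • (1 : Matrix (Fin d) (Fin d) ℝ)) := by fun_prop
    have := hc.tendsto 0
    simp only [zero_smul, add_zero] at this
    exact this.mono_left nhdsWithin_le_nhds
  have hpos : ∀ᶠ ε : ℝ in 𝓝[>] 0, 0 < ε := eventually_mem_nhdsWithin
  have hsqrtA : Tendsto (fun ε : ℝ => CFC.sqrt (A + ε • (1 : Matrix (Fin d) (Fin d) ℝ)))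
      (𝓝[>] 0) (𝓝 (CFC.sqrt A)) := by
    refine (continuousOn_matrix_sqrt A (Matrix.nonneg_iff_posSemidef.2 hA)).tendsto.comp
      (tendsto_nhdsWithin_iff.2 ⟨hcont A, ?_⟩)
    filter_upwards [hpos] with ε hε
    exact Matrix.nonneg_iff_posSemidef.2 (hA.add (hpd ε hε).posSemidef)
  have hprod := (hsqrtA.mul (hcont B)).mul hsqrtA
  have hsqrt := (continuousOn_matrix_sqrt _ (Matrix.nonneg_iff_posSemidef.2
    (sqrt_mul_mul_sqrt_nonneg A hB))).tendsto.comp (tendsto_nhdsWithin_iff.2 ⟨hprod, by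
      filter_upwards [hpos] with ε hε
      exact Matrix.nonneg_iff_posSemidef.2
        (sqrt_mul_mul_sqrt_nonneg _ (hB.add (hpd ε hε).posSemidef))⟩)
  have htr : Continuous (fun M : Matrix (Fin d) (Fin d) ℝ => M.trace) :=
    continuous_id.matrix_trace
  refine ge_of_tendsto ((htr.tendsto _).comp hsqrt) ?_
  filter_upwards [hpos] with ε hε
  refine BlockNonneg.trace_le_of_posDef (fun u v => ?_)
    (Matrix.PosDef.posSemidef_add hA (hpd ε hε)) (Matrix.PosDef.posSemidef_add hB (hpd ε hε))
  rw [dotProduct_add_smul_one_mulVec, dotProduct_add_smul_one_mulVec]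
  have h1 := h u v
  have h2 : 0 ≤ u ⬝ᵥ u := Finset.sum_nonneg fun i _ => mul_self_nonneg _
  have h3 : 0 ≤ v ⬝ᵥ v := Finset.sum_nonneg fun i _ => mul_self_nonneg _
  have h4 := mul_nonneg hε.le h2
  have h5 := mul_nonneg hε.le h3
  linarith

theorem isClosed_nonneg_matrix : IsClosed {A : Matrix (Fin d) (Fin d) ℝ | 0 ≤ A} := by
  have : {A : Matrix (Fin d) (Fin d) ℝ | 0 ≤ A} = {A | A.conjTranspose = A} ∩
      ⋂ x : Fin d → ℝ, {A | 0 ≤ x ⬝ᵥ A.mulVec x} := by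
    ext A
    simp [Matrix.nonneg_iff_posSemidef, Matrix.posSemidef_iff_dotProduct_mulVec,
      Matrix.IsHermitian]
  rw [this]
  refine (isClosed_eq (by fun_prop) continuous_id).inter (isClosed_iInter fun x => ?_)
  exact isClosed_le continuous_const (by fun_prop)

theorem measurable_bures {Ω : Type*} [MeasurableSpace Ω] {A : Ω → Matrix (Fin d) (Fin d) ℝ}
    (hA : ∀ i j, Measurable (fun ω => A ω i j)) (B : Matrix (Fin d) (Fin d) ℝ) :
    Measurable (fun ω => bures (A ω) B) := by
  let _ : MeasurableSpace (Matrix (Fin d) (Fin d) ℝ) :=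
    inferInstanceAs (MeasurableSpace (Fin d → Fin d → ℝ))
  have hborel : BorelSpace (Matrix (Fin d) (Fin d) ℝ) :=
    inferInstanceAs (BorelSpace (Fin d → Fin d → ℝ))
  have hAm : Measurable A := measurable_pi_lambda _ fun i => measurable_pi_lambda _ fun j => hA i j
  -- Here `CFC.sqrt` is continuous on the closed nonnegative cone and takes the default value `0`
  -- off it.
  have hsqrt : Measurable
      (CFC.sqrt : Matrix (Fin d) (Fin d) ℝ → Matrix (Fin d) (Fin d) ℝ) := by
    classical
    have h := continuousOn_matrix_sqrt.measurable_piecewise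
      (continuousOn_const (c := (0 : Matrix (Fin d) (Fin d) ℝ)))
      (isClosed_nonneg_matrix (d := d)).measurableSet
    convert h using 1
    ext1 A
    by_cases hA : 0 ≤ A
    · exact (Set.piecewise_eq_of_mem {A : Matrix (Fin d) (Fin d) ℝ | 0 ≤ A} _ _ hA).symm
    · rw [CFC.sqrt_of_not_nonneg hA]
      exact (Set.piecewise_eq_of_notMem {A : Matrix (Fin d) (Fin d) ℝ | 0 ≤ A} CFC.sqrt
        (fun _ => 0) hA).symm
  have hconj : Measurable (fun M : Matrix (Fin d) (Fin d) ℝ => M * B * M) :=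
    (by fun_prop : Continuous (fun M : Matrix (Fin d) (Fin d) ℝ => M * B * M)).measurable
  have htr : Measurable (fun M : Matrix (Fin d) (Fin d) ℝ => M.trace) :=
    (continuous_id.matrix_trace).measurable
  have : (fun ω => bures (A ω) B) = fun ω => Real.sqrt ((A ω).trace + B.trace -
      2 * (CFC.sqrt (CFC.sqrt (A ω) * B * CFC.sqrt (A ω))).trace) := by
    ext1 ω
    rw [bures, Matrix.trace_sub, Matrix.trace_add, Matrix.trace_smul, smul_eq_mul]
  rw [this]
  exact (((htr.comp hAm).add_const _).sub
    ((htr.comp (hsqrt.comp (hconj.comp (hsqrt.comp hAm)))).const_mul _)).sqrt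

end Matrices

/-! ### Second moments and Gelbrich's inequality. -/

section Gelbrich

variable {d : ℕ} {Z : Type*} [MeasurableSpace Z] {m : Measure Z}

/-- Matrix of second moments of two random vectors. -/
noncomputable def crossMoment (m : Measure Z) (F G : Z → E d) : Matrix (Fin d) (Fin d) ℝ :=
  Matrix.of fun i j => ∫ z, F z i * G z j ∂m

theorem memLp_apply {F : Z → E d} (hF : MemLp F 2 m) (i : Fin d) : MemLp (fun z => F z i) 2 m :=
  (EuclideanSpace.proj (𝕜 := ℝ) i).comp_memLp' hF

theorem integrable_mul_apply {F G : Z → E d} (hF : MemLp F 2 m) (hG : MemLp G 2 m)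
    (i j : Fin d) : Integrable (fun z => F z i * G z j) m :=
  (memLp_apply hF i).integrable_mul (memLp_apply hG j)

theorem dotProduct_crossMoment {F G : Z → E d} (hF : MemLp F 2 m) (hG : MemLp G 2 m)
    (u v : Fin d → ℝ) : u ⬝ᵥ (crossMoment m F G).mulVec v =
      ∫ z, (∑ i, u i * F z i) * (∑ j, v j * G z j) ∂m := by
  have hcomm : ∀ i j z, u i * F z i * (v j * G z j) = (u i * v j) * (F z i * G z j) :=
    fun i j z => by ring
  have hint : ∀ i j, Integrable (fun z => (u i * v j) * (F z i * G z j)) m := fun i j =>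
    (integrable_mul_apply hF hG i j).const_mul _
  simp_rw [Finset.sum_mul_sum, hcomm]
  rw [integral_finsetSum _ fun i _ => integrable_finsetSum _ fun j _ => hint i j]
  refine Finset.sum_congr rfl fun i _ => ?_
  rw [integral_finsetSum _ fun j _ => hint i j, Matrix.mulVec, dotProduct, Finset.mul_sum]
  refine Finset.sum_congr rfl fun j _ => ?_
  rw [crossMoment, Matrix.of_apply, integral_const_mul]
  ring

theorem memLp_sum_mul {F : Z → E d} (hF : MemLp F 2 m) (u : Fin d → ℝ) :
    MemLp (fun z => ∑ i, u i * F z i) 2 m :=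
  memLp_finsetSum _ fun i _ => (memLp_apply hF i).const_mul (u i)

/-- The block quadratic form at `(u, v)` is the second moment of `⟨u, F⟩ - ⟨v, G⟩`. -/
theorem blockNonneg_crossMoment {F G : Z → E d} (hF : MemLp F 2 m) (hG : MemLp G 2 m) :
    BlockNonneg (crossMoment m F F) (crossMoment m G G) (crossMoment m F G) := by
  intro u v
  rw [dotProduct_crossMoment hF hF, dotProduct_crossMoment hG hG, dotProduct_crossMoment hF hG,
    ← integral_const_mul, ← integral_add, ← integral_sub]
  · refine integral_nonneg fun z => ?_
    simp only [Pi.zero_apply]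
    nlinarith [sq_nonneg ((∑ i, u i * F z i) - ∑ i, v i * G z i)]
  · exact ((memLp_sum_mul hF u).integrable_mul (memLp_sum_mul hF u)).add
      ((memLp_sum_mul hG v).integrable_mul (memLp_sum_mul hG v))
  · exact ((memLp_sum_mul hF u).integrable_mul (memLp_sum_mul hG v)).const_mul _
  · exact (memLp_sum_mul hF u).integrable_mul (memLp_sum_mul hF u)
  · exact (memLp_sum_mul hG v).integrable_mul (memLp_sum_mul hG v)

theorem posSemidef_crossMoment {F : Z → E d} (hF : MemLp F 2 m) :
    (crossMoment m F F).PosSemidef := by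
  refine Matrix.PosSemidef.of_dotProduct_mulVec_nonneg ?_ fun u => ?_
  · ext i j
    simp [crossMoment, mul_comm]
  · rw [star_trivial, dotProduct_crossMoment hF hF]
    exact integral_nonneg fun z => mul_self_nonneg _

theorem integral_norm_sub_sq_eq_trace {F G : Z → E d} (hF : MemLp F 2 m) (hG : MemLp G 2 m) :
    ∫ z, ‖F z - G z‖ ^ 2 ∂m = (crossMoment m F F).trace + (crossMoment m G G).trace
      - 2 * (crossMoment m F G).trace := by
  simp_rw [EuclideanSpace.real_norm_sq_eq]
  have hsplit : ∀ i, ∀ z, (F z - G z) i ^ 2 = F z i * F z i + G z i * G z i -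
      2 * (F z i * G z i) := fun i z => by
    rw [PiLp.sub_apply]; ring
  have hint : ∀ i, Integrable (fun z => F z i * F z i + G z i * G z i -
      2 * (F z i * G z i)) m := fun i =>
    ((integrable_mul_apply hF hF i i).add (integrable_mul_apply hG hG i i)).sub
      ((integrable_mul_apply hF hG i i).const_mul 2)
  simp_rw [hsplit]
  rw [integral_finsetSum _ fun i _ => hint i, Matrix.trace, Matrix.trace, Matrix.trace,
    Finset.mul_sum, ← Finset.sum_add_distrib, ← Finset.sum_sub_distrib]
  refine Finset.sum_congr rfl fun i _ => ?_
  have hadd : Integrable (fun z => F z i * F z i + G z i * G z i) m :=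
    (integrable_mul_apply hF hF i i).add (integrable_mul_apply hG hG i i)
  rw [integral_sub hadd ((integrable_mul_apply hF hG i i).const_mul 2),
    integral_add (integrable_mul_apply hF hF i i) (integrable_mul_apply hG hG i i),
    integral_const_mul]
  rfl

theorem integral_norm_sub_sq_of_integral_eq_zero [IsProbabilityMeasure m] {H : Z → E d}
    (hH : MemLp H 2 m) (h0 : ∫ z, H z ∂m = 0) (c : E d) :
    ∫ z, ‖c + H z‖ ^ 2 ∂m = ‖c‖ ^ 2 + ∫ z, ‖H z‖ ^ 2 ∂m := by
  have hi : Integrable H m := hH.integrable (by norm_num)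
  simp_rw [norm_add_sq_real]
  have h1 : Integrable (fun z => 2 * inner ℝ c (H z)) m := (hi.const_inner c).const_mul 2
  have h2 : Integrable (fun z => ‖c‖ ^ 2 + 2 * inner ℝ c (H z)) m := (integrable_const _).add h1
  rw [integral_add h2 (hH.integrable_norm_pow (by norm_num)),
    integral_add (integrable_const _) h1, integral_const_mul, integral_inner hi, h0]
  simp

/-- Gelbrich's inequality for two random vectors on a common probability space. -/
theorem norm_sq_add_bures_sq_le [IsProbabilityMeasure m] {f g : Z → E d} (hf : MemLp f 2 m)
    (hg : MemLp g 2 m) :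
    ‖(∫ z, f z ∂m) - ∫ z, g z ∂m‖ ^ 2 +
      bures (crossMoment m (fun z => f z - ∫ z, f z ∂m) (fun z => f z - ∫ z, f z ∂m))
        (crossMoment m (fun z => g z - ∫ z, g z ∂m) (fun z => g z - ∫ z, g z ∂m)) ^ 2 ≤
      ∫ z, ‖f z - g z‖ ^ 2 ∂m := by
  set a := ∫ z, f z ∂m with ha
  set b := ∫ z, g z ∂m with hb
  set F : Z → E d := fun z => f z - a with hFdef
  set G : Z → E d := fun z => g z - b with hGdef
  have hF : MemLp F 2 m := hf.sub (memLp_const a)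
  have hG : MemLp G 2 m := hg.sub (memLp_const b)
  have hfi : Integrable f m := hf.integrable (by norm_num)
  have hgi : Integrable g m := hg.integrable (by norm_num)
  have h0 : ∫ z, (F z - G z) ∂m = 0 := by
    rw [integral_sub (hF.integrable (by norm_num)) (hG.integrable (by norm_num)),
      integral_sub hfi (integrable_const _), integral_sub hgi (integrable_const _)]
    simp [← ha, ← hb]
  have hfg : ∀ z, f z - g z = (a - b) + (F z - G z) := fun z => by
    simp only [hFdef, hGdef]; abel
  simp_rw [hfg]
  -- The centred part is orthogonal to the constant `a - b`, so the squared mean difference splits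
  -- off exactly and only the Bures term remains.
  rw [integral_norm_sub_sq_of_integral_eq_zero (H := fun z => F z - G z) (hF.sub hG) h0 (a - b)]
  gcongr
  have htr := (blockNonneg_crossMoment hF hG).trace_le (posSemidef_crossMoment hF)
    (posSemidef_crossMoment hG)
  have heq := integral_norm_sub_sq_eq_trace hF hG
  have hnn : 0 ≤ ∫ z, ‖F z - G z‖ ^ 2 ∂m := integral_nonneg fun z => by positivity
  rw [bures, Matrix.trace_sub, Matrix.trace_add, Matrix.trace_smul, smul_eq_mul]
  -- In the negative case `Real.sqrt` returns `0`, so nonnegativity of the Bures trace need not be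
  -- proved.
  by_cases hs : 0 ≤ (crossMoment m F F).trace + (crossMoment m G G).trace -
      2 * (CFC.sqrt (CFC.sqrt (crossMoment m F F) * crossMoment m G G *
        CFC.sqrt (crossMoment m F F))).trace
  · rw [Real.sq_sqrt hs]
    linarith
  · rw [Real.sqrt_eq_zero_of_nonpos (not_le.1 hs).le]
    simpa using hnn

theorem mean_eq_integral {μ : P2 d} {f : Z → E d} (hf : Measurable f)
    (h : m.map f = (μ : Measure (E d))) : mean μ = ∫ z, f z ∂m := by
  rw [mean, ← h, integral_map hf.aemeasurable (by fun_prop)]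

theorem covMatrix_eq_crossMoment {μ : P2 d} {f : Z → E d} (hf : Measurable f)
    (h : m.map f = (μ : Measure (E d))) :
    covMatrix μ = crossMoment m (fun z => f z - ∫ z, f z ∂m) (fun z => f z - ∫ z, f z ∂m) := by
  ext i j
  rw [covMatrix, crossMoment, Matrix.of_apply, Matrix.of_apply, ← mean_eq_integral hf h, ← h,
    integral_map hf.aemeasurable (by fun_prop)]
  rfl

end Gelbrich

/-! ### Quantities controlled by the Wasserstein distance. -/

theorem MemLp.eLpNorm_two_eq {Z F : Type*} [MeasurableSpace Z] [NormedAddCommGroup F]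
    {m : Measure Z} {f : Z → F} (hf : MemLp f 2 m) :
    (eLpNorm f 2 m).toReal ^ 2 = ∫ z, ‖f z‖ ^ 2 ∂m := by
  rw [← ENNReal.toReal_pow, eLpNorm_two_sq, integral_eq_lintegral_of_nonneg_ae
    (f := fun z => ‖f z‖ ^ 2)
    (ae_of_all _ fun z => sq_nonneg _) (hf.1.norm.pow 2)]
  congr 1
  refine lintegral_congr fun z => ?_
  rw [ENNReal.ofReal_pow (norm_nonneg _), ofReal_norm]

theorem memLp_fst_of_mem_plans {d : ℕ} {μ : P2 d} {ν : Measure (E d)} {γ : Measure (E d × E d)}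
    (h : γ ∈ plans (μ : Measure (E d)) ν) : MemLp (fun p => p.1) 2 γ :=
  ⟨by fun_prop, (eLpNorm_comp_fst_of_mem_plans (f := id) h (by fun_prop)).trans_lt μ.memLp_id.2⟩

theorem memLp_snd_of_mem_plans {d : ℕ} {μ : Measure (E d)} {ν : P2 d} {γ : Measure (E d × E d)}
    (h : γ ∈ plans μ (ν : Measure (E d))) : MemLp (fun p => p.2) 2 γ :=
  ⟨by fun_prop, (eLpNorm_comp_snd_of_mem_plans (f := id) h (by fun_prop)).trans_lt ν.memLp_id.2⟩

theorem W2_sq_eq_integral {d : ℕ} {μ ν : P2 d} {γ : Measure (E d × E d)}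
    (h : γ ∈ optimalPlans (μ : Measure (E d)) (ν : Measure (E d))) :
    W2 μ ν ^ 2 = ∫ p, ‖p.1 - p.2‖ ^ 2 ∂γ := by
  rw [W2, eW2_eq_displacement h, displacement, MemLp.eLpNorm_two_eq]
  exact (memLp_fst_of_mem_plans h.1).sub (memLp_snd_of_mem_plans h.1)

theorem sqrt_mean_bures_le_W2 {d : ℕ} {μ ν : P2 d}
    (hopt : (optimalPlans (μ : Measure (E d)) (ν : Measure (E d))).Nonempty) :
    Real.sqrt (‖mean μ - mean ν‖ ^ 2 + bures (covMatrix μ) (covMatrix ν) ^ 2) ≤ W2 μ ν := by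
  obtain ⟨γ, hγ⟩ := hopt
  have := isProbabilityMeasure_of_mem_plans hγ.1
  refine Real.sqrt_le_iff.2 ⟨W2_nonneg _ _, ?_⟩
  rw [W2_sq_eq_integral hγ, mean_eq_integral measurable_fst hγ.1.1,
    mean_eq_integral measurable_snd hγ.1.2, covMatrix_eq_crossMoment measurable_fst hγ.1.1,
    covMatrix_eq_crossMoment measurable_snd hγ.1.2]
  exact norm_sq_add_bures_sq_le (memLp_fst_of_mem_plans hγ.1) (memLp_snd_of_mem_plans hγ.1)

theorem memLp_lipschitz {d : ℕ} {L : ℝ≥0} {φ : E d → ℝ} (hφ : LipschitzWith L φ) (μ : P2 d) :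
    MemLp φ 2 (μ : Measure (E d)) := by
  have hb : MemLp (fun x : E d => L * ‖x‖ + ‖φ 0‖) 2 (μ : Measure (E d)) :=
    (μ.memLp_id.norm.const_mul (L : ℝ)).add (memLp_const _)
  refine hb.mono hφ.continuous.aestronglyMeasurable (ae_of_all _ fun x => ?_)
  have h1 := hφ.dist_le_mul x 0
  rw [dist_eq_norm, dist_zero_right] at h1
  have h2 := norm_add_le (φ x - φ 0) (φ 0)
  rw [sub_add_cancel] at h2
  refine le_trans ?_ (le_abs_self _)
  linarith

theorem l2norm_eq_toReal_eLpNorm {d : ℕ} {φ : E d → ℝ} {μ : P2 d}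
    (hφ : MemLp φ 2 (μ : Measure (E d))) :
    l2norm φ μ = (eLpNorm φ 2 (μ : Measure (E d))).toReal := by
  rw [l2norm, ← Real.sqrt_sq (ENNReal.toReal_nonneg (a := eLpNorm φ 2 (μ : Measure (E d)))),
    MemLp.eLpNorm_two_eq hφ]
  simp

/-- Under an optimal plan both norms live in the same `L²` space, so this is the reverse triangle
inequality followed by the Lipschitz bound. -/
theorem abs_l2norm_sub_le {d : ℕ} {L : ℝ≥0} {φ : E d → ℝ} (hφ : LipschitzWith L φ) {μ ν : P2 d}
    (hopt : (optimalPlans (μ : Measure (E d)) (ν : Measure (E d))).Nonempty) :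
    |l2norm φ μ - l2norm φ ν| ≤ L * W2 μ ν := by
  obtain ⟨γ, hγ⟩ := hopt
  have hφc := hφ.continuous
  have h1 := eLpNorm_comp_fst_of_mem_plans hγ.1 (f := φ) hφc.aestronglyMeasurable
  have h2 := eLpNorm_comp_snd_of_mem_plans hγ.1 (f := φ) hφc.aestronglyMeasurable
  have hm1 : MemLp (fun p : E d × E d => φ p.1) 2 γ :=
    ⟨by fun_prop, h1.trans_lt (memLp_lipschitz hφ μ).2⟩
  have hm2 : MemLp (fun p : E d × E d => φ p.2) 2 γ :=
    ⟨by fun_prop, h2.trans_lt (memLp_lipschitz hφ ν).2⟩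
  rw [l2norm_eq_toReal_eLpNorm (memLp_lipschitz hφ μ),
    l2norm_eq_toReal_eLpNorm (memLp_lipschitz hφ ν), ← h1, ← h2]
  have hd : (eLpNorm (fun p : E d × E d => φ p.1 - φ p.2) 2 γ).toReal ≤ L * W2 μ ν := by
    rw [W2, eW2_eq_displacement hγ, displacement, ← ENNReal.coe_toReal, ← ENNReal.toReal_mul]
    refine ENNReal.toReal_mono ?_ ?_
    · exact ENNReal.mul_ne_top ENNReal.coe_ne_top
        ((memLp_fst_of_mem_plans hγ.1).sub (memLp_snd_of_mem_plans hγ.1)).2.ne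
    · refine eLpNorm_le_nnreal_smul_eLpNorm_of_ae_le_mul (ae_of_all _ fun p => ?_) 2
      exact hφ.norm_sub_le p.1 p.2
  have hne : eLpNorm (fun p : E d × E d => φ p.1 - φ p.2) 2 γ ≠ ∞ := (hm1.sub hm2).2.ne
  rw [abs_le]
  constructor
  · have htri : eLpNorm (fun p : E d × E d => φ p.2) 2 γ ≤
        eLpNorm (fun p : E d × E d => φ p.1) 2 γ +
          eLpNorm (fun p : E d × E d => φ p.1 - φ p.2) 2 γ := by
      refine le_trans (le_of_eq ?_)
        (eLpNorm_sub_le (μ := γ) (p := 2) hm1.1 (hm1.sub hm2).1 (by norm_num))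
      congr 1
      ext p : 1
      simp
    have := ENNReal.toReal_mono (ENNReal.add_ne_top.2 ⟨hm1.2.ne, hne⟩) htri
    rw [ENNReal.toReal_add hm1.2.ne hne] at this
    linarith
  · have htri : eLpNorm (fun p : E d × E d => φ p.1) 2 γ ≤
        eLpNorm (fun p : E d × E d => φ p.2) 2 γ +
          eLpNorm (fun p : E d × E d => φ p.1 - φ p.2) 2 γ := by
      refine le_trans (le_of_eq ?_)
        (eLpNorm_add_le (μ := γ) (p := 2) hm2.1 (hm1.sub hm2).1 (by norm_num))
      congr 1
      ext p : 1
      simp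
    have := ENNReal.toReal_mono (ENNReal.add_ne_top.2 ⟨hm2.2.ne, hne⟩) htri
    rw [ENNReal.toReal_add hm2.2.ne hne] at this
    linarith

/-! ### Regular conditional probabilities. -/

section CondExpKernel

variable {Ω : Type*} {m : MeasurableSpace Ω} [mΩ : MeasurableSpace Ω] [StandardBorelSpace Ω]
  {P : Measure Ω} [IsFiniteMeasure P]

theorem measurable_condExpKernel_measure (hm : m ≤ mΩ) :
    Measurable (fun ω => condExpKernel P m ω) :=
  (condExpKernel P m).measurable.mono hm le_rfl

/-- The tower property at the level of measures: it transfers null sets and integrals between `P`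
and the conditional laws. -/
theorem bind_condExpKernel (hm : m ≤ mΩ) : P.bind (fun ω => condExpKernel P m ω) = P := by
  ext s hs
  rw [Measure.bind_apply hs (measurable_condExpKernel_measure hm).aemeasurable]
  conv_rhs => rw [← condExpKernel_comp_trim (μ := P) hm]
  rw [Measure.bind_apply hs (condExpKernel P m).measurable.aemeasurable,
    lintegral_trim hm (measurable_condExpKernel hs)]

theorem ae_ae_condExpKernel (hm : m ≤ mΩ) {p : Ω → Prop} (h : ∀ᵐ ω ∂P, p ω) :
    ∀ᵐ ω ∂P, ∀ᵐ ω' ∂(condExpKernel P m ω), p ω' := by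
  rw [← bind_condExpKernel (P := P) hm] at h
  exact Measure.ae_ae_of_ae_bind (measurable_condExpKernel_measure hm).aemeasurable h

theorem ae_of_ae_ae_condExpKernel (hm : m ≤ mΩ) {p : Ω → Prop} (hp : MeasurableSet {ω | p ω})
    (h : ∀ᵐ ω ∂P, ∀ᵐ ω' ∂(condExpKernel P m ω), p ω') : ∀ᵐ ω ∂P, p ω := by
  rw [ae_iff]
  change P {ω | p ω}ᶜ = 0
  rw [← bind_condExpKernel (P := P) hm, Measure.bind_apply hp.compl
    (measurable_condExpKernel_measure hm).aemeasurable,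
    lintegral_eq_zero_iff ((measurable_condExpKernel hp.compl).mono hm le_rfl)]
  exact h

theorem lintegral_condExpKernel (hm : m ≤ mΩ) {f : Ω → ℝ≥0∞} (hf : AEMeasurable f P) :
    ∫⁻ ω, ∫⁻ ω', f ω' ∂(condExpKernel P m ω) ∂P = ∫⁻ ω, f ω ∂P := by
  have hb := bind_condExpKernel (P := P) hm
  conv_rhs => rw [← hb]
  rw [Measure.lintegral_bind (measurable_condExpKernel_measure hm).aemeasurable (by rwa [hb])]

/-- The regular conditional probability given `m` charges almost surely only the part of an
`m`-measurable event that contains the conditioning point. -/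
theorem ae_condExpKernel_mem_iff (hm : m ≤ mΩ) {s : Set Ω} (hs : MeasurableSet[m] s) :
    ∀ᵐ ω ∂P, ∀ᵐ ω' ∂(condExpKernel P m ω), (ω' ∈ s ↔ ω ∈ s) := by
  -- One direction suffices, applied to both `s` and its complement.
  have key : ∀ t : Set Ω, MeasurableSet[m] t →
      ∀ᵐ ω ∂P, ω ∉ t → ∀ᵐ ω' ∂(condExpKernel P m ω), ω' ∉ t := by
    intro t ht
    have h1 := condExpKernel_ae_eq_condExp (μ := P) hm (hm _ ht)
    rw [condExp_of_stronglyMeasurable hm (stronglyMeasurable_const.indicator ht)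
      ((integrable_const _).indicator (hm _ ht))] at h1
    filter_upwards [h1] with ω hω hωt
    rw [Set.indicator_of_notMem hωt, measureReal_eq_zero_iff] at hω
    exact measure_eq_zero_iff_ae_notMem.1 hω
  filter_upwards [key s hs, key sᶜ hs.compl] with ω h1 h2
  by_cases hω : ω ∈ s
  · filter_upwards [h2 (by simpa using hω)] with ω' hω'
    simpa [hω] using hω'
  · filter_upwards [h1 hω] with ω' hω'
    simpa [hω] using hω'

/-- Countably many rational sublevel sets determine the value, so the exceptional sets combine into
a single null set. -/
theorem ae_condExpKernel_eq_real (hm : m ≤ mΩ) {f : Ω → ℝ} (hf : Measurable[m] f) :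
    ∀ᵐ ω ∂P, ∀ᵐ ω' ∂(condExpKernel P m ω), f ω' = f ω := by
  have h : ∀ᵐ ω ∂P, ∀ q : ℚ, ∀ᵐ ω' ∂(condExpKernel P m ω), (f ω' < q ↔ f ω < q) :=
    ae_all_iff.2 fun q => ae_condExpKernel_mem_iff hm (hf measurableSet_Iio)
  filter_upwards [h] with ω hω
  filter_upwards [ae_all_iff.2 hω] with ω' hω'
  refine le_antisymm (le_of_not_gt fun hlt => ?_) (le_of_not_gt fun hlt => ?_)
  · obtain ⟨q, hq1, hq2⟩ := exists_rat_btwn hlt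
    exact (lt_asymm hq2 ((hω' q).2 hq1)).elim
  · obtain ⟨q, hq1, hq2⟩ := exists_rat_btwn hlt
    exact (lt_asymm hq2 ((hω' q).1 hq1)).elim

theorem exists_countable_piSystem (X : Type*) [mX : MeasurableSpace X]
    [MeasurableSpace.CountablyGenerated X] : ∃ S : Set (Set X), S.Countable ∧ IsPiSystem S ∧
      mX = MeasurableSpace.generateFrom S := by
  refine ⟨generateSetAlgebra (MeasurableSpace.countableGeneratingSet X),
    countable_generateSetAlgebra MeasurableSpace.countable_countableGeneratingSet,
    fun s hs t ht _ => isSetAlgebra_generateSetAlgebra.inter_mem hs ht, ?_⟩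
  rw [generateFrom_generateSetAlgebra_eq, MeasurableSpace.generateFrom_countableGeneratingSet]

/-- An `m`-measurable random probability measure is almost surely constant under the regular
conditional probability given `m`. -/
theorem ae_condExpKernel_eq_measure {X : Type*} [mX : MeasurableSpace X]
    [MeasurableSpace.CountablyGenerated X] (hm : m ≤ mΩ) {K : Ω → Measure X}
    (hK : Measurable[m] K) (hprob : ∀ ω, IsProbabilityMeasure (K ω)) :
    ∀ᵐ ω ∂P, ∀ᵐ ω' ∂(condExpKernel P m ω), K ω' = K ω := by
  obtain ⟨S, hSc, hSpi, hSgen⟩ := exists_countable_piSystem X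
  have hSm : ∀ s ∈ S, MeasurableSet s := fun s hs => by
    rw [hSgen]; exact MeasurableSpace.measurableSet_generateFrom hs
  -- A countable π-system determines a probability measure and needs only one null set.
  have h : ∀ᵐ ω ∂P, ∀ s ∈ S, ∀ᵐ ω' ∂(condExpKernel P m ω), (K ω').real s = (K ω).real s :=
    (ae_ball_iff hSc).2 fun s hs => ae_condExpKernel_eq_real hm
      (((Measure.measurable_coe (hSm s hs)).comp hK).ennreal_toReal)
  filter_upwards [h] with ω hω
  filter_upwards [(ae_ball_iff hSc).2 hω] with ω' hω'
  have := hprob ω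
  have := hprob ω'
  refine ext_of_generate_finite S hSgen hSpi (fun s hs => ?_) (by simp)
  exact (measureReal_eq_measureReal_iff).1 (hω' s hs)

end CondExpKernel

/-! ### Random measures and the expected gradient step. -/

theorem measurable_map_kernel {Ω X Y : Type*} [MeasurableSpace Ω] [MeasurableSpace X]
    [MeasurableSpace Y] {K : Ω → Measure X} (hK : Measurable K)
    (hprob : ∀ ω, IsProbabilityMeasure (K ω)) {f : Ω → X → Y}
    (hf : Measurable (fun p : Ω × X => f p.1 p.2)) : Measurable (fun ω => (K ω).map (f ω)) := by
  let κ : Kernel Ω X := ⟨K, hK⟩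
  have : IsMarkovKernel κ := ⟨hprob⟩
  refine Measure.measurable_of_measurable_coe _ fun s hs => ?_
  have h := Kernel.measurable_kernel_prodMk_left (κ := κ) (hf hs)
  convert h using 1
  ext1 ω
  have hfω : Measurable (f ω) := hf.comp measurable_prodMk_left
  rw [Measure.map_apply hfω hs]
  rfl

theorem measurable_lintegral_kernel {Ω X : Type*} [MeasurableSpace Ω] [MeasurableSpace X]
    {K : Ω → Measure X} (hK : Measurable K) (hprob : ∀ ω, IsProbabilityMeasure (K ω))
    {f : Ω → X → ℝ≥0∞} (hf : Measurable (fun p : Ω × X => f p.1 p.2)) :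
    Measurable (fun ω => ∫⁻ x, f ω x ∂(K ω)) := by
  let κ : Kernel Ω X := ⟨K, hK⟩
  have : IsMarkovKernel κ := ⟨hprob⟩
  exact Measurable.lintegral_kernel_prod_right (κ := κ) hf

theorem measurable_integral_kernel {Ω X F : Type*} [MeasurableSpace Ω] [MeasurableSpace X]
    [NormedAddCommGroup F] [NormedSpace ℝ F] [MeasurableSpace F] [BorelSpace F]
    [SecondCountableTopology F]
    {K : Ω → Measure X} (hK : Measurable K) (hprob : ∀ ω, IsProbabilityMeasure (K ω))
    {f : Ω → X → F} (hf : Measurable (fun p : Ω × X => f p.1 p.2)) :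
    Measurable (fun ω => ∫ x, f ω x ∂(K ω)) := by
  let κ : Kernel Ω X := ⟨K, hK⟩
  have : IsMarkovKernel κ := ⟨hprob⟩
  exact (StronglyMeasurable.integral_kernel_prod_right (κ := κ) hf.stronglyMeasurable).measurable

/-- The expected squared distance after one gradient step, for a random vector field `ξ` with
given mean and second moment bound. -/
theorem lintegral_eLpNorm_gradient_step_le {d : ℕ} {Ω : Type*} [MeasurableSpace Ω] {M : Measure Ω}
    [IsProbabilityMeasure M] {ξ : Ω → E d → E d}
    (hξ : Measurable (fun p : Ω × E d => ξ p.1 p.2)) {μ ν : P2 d} {γ : Measure (E d × E d)}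
    (hγ : γ ∈ optimalPlans (μ : Measure (E d)) (ν : Measure (E d))) {g : E d → E d}
    (hmean : ∀ᵐ x ∂(μ : Measure (E d)), ∫ ω, ξ ω x ∂M = g x) {b : ℝ} (hb : 0 ≤ b)
    (hbound : ∫⁻ ω, eLpNorm (ξ ω) 2 (μ : Measure (E d)) ^ 2 ∂M ≤ ENNReal.ofReal b) (τ : ℝ) :
    ∫⁻ ω, eLpNorm (fun p : E d × E d => p.1 - τ • ξ ω p.1 - p.2) 2 γ ^ 2 ∂M ≤
      ENNReal.ofReal (W2 μ ν ^ 2 + 2 * τ * ∫ p, inner ℝ (g p.1) (p.2 - p.1) ∂γ + τ ^ 2 * b) := by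
  have := isProbabilityMeasure_of_mem_plans hγ.1
  set D : Ω × E d × E d → E d := fun q => q.2.1 - q.2.2 with hD
  set H : Ω × E d × E d → E d := fun q => ξ q.1 q.2.1 with hH
  have hDm : Measurable D := by fun_prop
  have hHm : Measurable H := hξ.comp (by fun_prop : Measurable
    (fun q : Ω × E d × E d => (q.1, q.2.1)))
  have hξω : ∀ ω, Measurable (ξ ω) := fun ω => hξ.comp measurable_prodMk_left
  have hDLp : MemLp D 2 (M.prod γ) :=
    ((memLp_fst_of_mem_plans hγ.1).sub (memLp_snd_of_mem_plans hγ.1)).comp_snd M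
  have hHsq : ∫⁻ q, ‖H q‖ₑ ^ 2 ∂(M.prod γ) ≤ ENNReal.ofReal b := by
    rw [lintegral_prod _ (by fun_prop)]
    refine le_trans (le_of_eq (lintegral_congr fun ω => ?_)) hbound
    rw [← eLpNorm_comp_fst_of_mem_plans hγ.1 (hξω ω).aestronglyMeasurable, eLpNorm_two_sq]
  have hHLp : MemLp H 2 (M.prod γ) := by
    refine ⟨hHm.aestronglyMeasurable, ?_⟩
    rw [← eLpNorm_two_sq] at hHsq
    by_contra hc
    rw [not_lt, top_le_iff] at hc
    rw [hc] at hHsq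
    simp at hHsq
  have hHb : ∫ q, ‖H q‖ ^ 2 ∂(M.prod γ) ≤ b := by
    rw [← MemLp.eLpNorm_two_eq hHLp, ← ENNReal.toReal_pow, eLpNorm_two_sq]
    exact ENNReal.toReal_le_of_le_ofReal hb hHsq
  have hDint : ∫ q, ‖D q‖ ^ 2 ∂(M.prod γ) = W2 μ ν ^ 2 := by
    rw [W2_sq_eq_integral hγ]
    have := integral_fun_snd (μ := M) (ν := γ) (fun p : E d × E d => ‖p.1 - p.2‖ ^ 2)
    simpa using this
  have hinner : Integrable (fun q => inner ℝ (D q) (H q)) (M.prod γ) := by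
    refine ((hDLp.integrable_norm_pow (by norm_num)).add
      (hHLp.integrable_norm_pow (by norm_num))).mono (hDLp.1.inner hHLp.1)
      (ae_of_all _ fun q => ?_)
    have h1 := abs_real_inner_le_norm (D q) (H q)
    refine le_trans ?_ (le_abs_self _)
    simp only [Pi.add_apply, Real.norm_eq_abs]
    nlinarith [sq_nonneg (‖D q‖ - ‖H q‖), norm_nonneg (D q), norm_nonneg (H q)]
  have hHint : Integrable H (M.prod γ) := hHLp.integrable (by norm_num)
  -- Integrate over the sample first: the displacement depends only on `p`, so the mean of `ξ`
  -- enters the inner product directly.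
  have hcross : ∫ q, inner ℝ (D q) (H q) ∂(M.prod γ) =
      - ∫ p, inner ℝ (g p.1) (p.2 - p.1) ∂γ := by
    rw [integral_prod_symm _ hinner, ← integral_neg]
    refine integral_congr_ae ?_
    have hm : ∀ᵐ p ∂γ, ∫ ω, ξ ω p.1 ∂M = g p.1 := by
      refine ae_of_ae_map measurable_fst.aemeasurable (p := fun x => ∫ ω, ξ ω x ∂M = g x) ?_
      rw [hγ.1.1]
      exact hmean
    filter_upwards [hm, hHint.prod_left_ae] with p hp hi
    simp only [hD]
    rw [integral_inner hi, hp, real_inner_comm, ← inner_neg_right, neg_sub]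
  have hS : MemLp (fun q => D q - τ • H q) 2 (M.prod γ) := hDLp.sub (hHLp.const_smul τ)
  have hexp : ∫ q, ‖D q - τ • H q‖ ^ 2 ∂(M.prod γ) = W2 μ ν ^ 2 +
      2 * τ * ∫ p, inner ℝ (g p.1) (p.2 - p.1) ∂γ + τ ^ 2 * ∫ q, ‖H q‖ ^ 2 ∂(M.prod γ) := by
    have he : ∀ q, ‖D q - τ • H q‖ ^ 2 =
        ‖D q‖ ^ 2 - 2 * τ * inner ℝ (D q) (H q) + τ ^ 2 * ‖H q‖ ^ 2 := fun q => by
      rw [norm_sub_sq_real, real_inner_smul_right, norm_smul, mul_pow, Real.norm_eq_abs, sq_abs]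
      ring
    simp_rw [he]
    have h1 : Integrable (fun q => ‖D q‖ ^ 2) (M.prod γ) :=
      hDLp.integrable_norm_pow (by norm_num)
    have h2 : Integrable (fun q => 2 * τ * inner ℝ (D q) (H q)) (M.prod γ) := hinner.const_mul _
    have h3 : Integrable (fun q => τ ^ 2 * ‖H q‖ ^ 2) (M.prod γ) :=
      (hHLp.integrable_norm_pow (by norm_num)).const_mul _
    have h12 : Integrable (fun q => ‖D q‖ ^ 2 - 2 * τ * inner ℝ (D q) (H q)) (M.prod γ) :=
      h1.sub h2
    rw [integral_add h12 h3, integral_sub h1 h2, integral_const_mul, integral_const_mul, hDint,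
      hcross]
    ring
  have hleft : ∫⁻ ω, eLpNorm (fun p : E d × E d => p.1 - τ • ξ ω p.1 - p.2) 2 γ ^ 2 ∂M =
      ∫⁻ q, ‖D q - τ • H q‖ₑ ^ 2 ∂(M.prod γ) := by
    rw [lintegral_prod _ (by fun_prop)]
    refine lintegral_congr fun ω => ?_
    rw [eLpNorm_two_sq]
    refine lintegral_congr fun p => ?_
    simp only [hD, hH, sub_right_comm]
  rw [hleft, ← eLpNorm_two_sq, ← ENNReal.ofReal_toReal (ENNReal.pow_ne_top hS.2.ne),
    ENNReal.toReal_pow, MemLp.eLpNorm_two_eq hS, hexp]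
  gcongr

theorem measurable_gradient_step_map {d : ℕ} {Ω : Type*} [MeasurableSpace Ω]
    {K : Ω → Measure (E d)}
    (hK : Measurable K) (hprob : ∀ ω, IsProbabilityMeasure (K ω)) {ξ : Ω → E d → E d}
    (hξ : Measurable (fun p : Ω × E d => ξ p.1 p.2)) {pr : E d → E d} (hpr : Measurable pr)
    (τ : ℝ) : Measurable (fun ω => (K ω).map (fun x => pr (x - τ • ξ ω x))) :=
  measurable_map_kernel hK hprob (f := fun ω x => pr (x - τ • ξ ω x))
    (hpr.comp (measurable_snd.sub (hξ.const_smul τ)))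

/-! ### Adapted versions and the conditional one-step estimate. -/

section Iterates

variable {Ω : Type*} {d : ℕ}

/-- `K` is a version of the random measure `μ` that is measurable for the `σ`-algebra `m`. -/
structure IsVersion (m : MeasurableSpace Ω) [mΩ : MeasurableSpace Ω] (P : Measure Ω)
    (μ : Ω → P2 d) (K : Ω → Measure (E d)) : Prop where
  measurable : Measurable[m] K
  isProbabilityMeasure : ∀ ω, IsProbabilityMeasure (K ω)
  ae_eq : ∀ᵐ ω ∂P, (μ ω : Measure (E d)) = K ω

variable {m : MeasurableSpace Ω} [mΩ : MeasurableSpace Ω] {P : Measure Ω} {μ : Ω → P2 d}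
  {K : Ω → Measure (E d)}

theorem IsVersion.measurable_of_le (h : IsVersion m P μ K) (hm : m ≤ mΩ) : Measurable K :=
  h.measurable.mono hm le_rfl

theorem IsVersion.aemeasurable_eW2 (h : IsVersion m P μ K) (hm : m ≤ mΩ) (ν : Measure (E d)) :
    AEMeasurable (fun ω => eW2 (μ ω : Measure (E d)) ν) P := by
  refine (WassersteinGF.aemeasurable_eW2 (h.measurable_of_le hm) h.isProbabilityMeasure
    ?_ ν).congr ?_
  · filter_upwards [h.ae_eq] with ω hω
    rw [← hω]
    exact (μ ω).memLp_id
  · filter_upwards [h.ae_eq] with ω hω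
    rw [hω]

theorem IsVersion.aemeasurable_W2 (h : IsVersion m P μ K) (hm : m ≤ mΩ) (ν : P2 d) :
    AEMeasurable (fun ω => W2 (μ ω) ν) P :=
  (h.aemeasurable_eW2 hm ν).ennreal_toReal

theorem IsVersion.aemeasurable_sqrt_mean_bures (h : IsVersion m P μ K) (hm : m ≤ mΩ)
    (ν : P2 d) : AEMeasurable (fun ω => Real.sqrt (‖mean (μ ω) - mean ν‖ ^ 2 +
      bures (covMatrix (μ ω)) (covMatrix ν) ^ 2)) P := by
  have hK := h.measurable_of_le hm
  have hmean : Measurable (fun ω => ∫ x, x ∂(K ω)) :=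
    measurable_integral_kernel hK h.isProbabilityMeasure (by fun_prop)
  have hcoord : ∀ i : Fin d, Measurable (fun p : Ω × E d => p.2 i - (∫ y, y ∂(K p.1)) i) :=
    fun i => ((by fun_prop : Measurable (fun x : E d => x i)).comp measurable_snd).sub
      ((by fun_prop : Measurable (fun x : E d => x i)).comp (hmean.comp measurable_fst))
  have hcov : ∀ i j : Fin d, Measurable (fun ω =>
      ∫ x, (x i - (∫ y, y ∂(K ω)) i) * (x j - (∫ y, y ∂(K ω)) j) ∂(K ω)) := fun i j =>
    measurable_integral_kernel hK h.isProbabilityMeasure ((hcoord i).mul (hcoord j))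
  have hb := measurable_bures (A := fun ω => Matrix.of fun i j =>
    ∫ x, (x i - (∫ y, y ∂(K ω)) i) * (x j - (∫ y, y ∂(K ω)) j) ∂(K ω)) hcov (covMatrix ν)
  refine ((((hmean.sub_const (mean ν)).norm.pow_const 2).add
    (hb.pow_const 2)).sqrt).aemeasurable.congr ?_
  filter_upwards [h.ae_eq] with ω hω
  have h1 : mean (μ ω) = ∫ x, x ∂(K ω) := by rw [mean, hω]
  have h2 : covMatrix (μ ω) = Matrix.of fun i j =>
      ∫ x, (x i - (∫ y, y ∂(K ω)) i) * (x j - (∫ y, y ∂(K ω)) j) ∂(K ω) := by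
    rw [covMatrix, h1, hω]
  rw [h1, h2]
  rfl

theorem IsVersion.aemeasurable_abs_l2norm_sub (h : IsVersion m P μ K) (hm : m ≤ mΩ) {φ : E d → ℝ}
    (hφ : Measurable φ) (ν : P2 d) :
    AEMeasurable (fun ω => |l2norm φ (μ ω) - l2norm φ ν|) P := by
  have hint : Measurable (fun ω => ∫ x, φ x ^ 2 ∂(K ω)) :=
    measurable_integral_kernel (h.measurable_of_le hm) h.isProbabilityMeasure (by fun_prop)
  refine ((hint.sqrt.sub_const (l2norm φ ν)).norm).aemeasurable.congr ?_
  filter_upwards [h.ae_eq] with ω hω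
  rw [l2norm.eq_1 φ (μ ω), hω, Real.norm_eq_abs]

/-- This justifies holding the current measure fixed under the conditional law, although the family
`μ` itself need not be measurable. -/
theorem IsVersion.ae_ae_eq [StandardBorelSpace Ω] [IsFiniteMeasure P] (h : IsVersion m P μ K)
    (hm : m ≤ mΩ) : ∀ᵐ ω ∂P, ∀ᵐ ω' ∂(condExpKernel P m ω), K ω' = μ ω ∧ μ ω' = μ ω := by
  filter_upwards [h.ae_eq, ae_ae_condExpKernel hm h.ae_eq,
    ae_condExpKernel_eq_measure hm h.measurable h.isProbabilityMeasure] with ω h1 h2 h3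
  filter_upwards [h2, h3] with ω' h4 h5
  exact ⟨h5.trans h1.symm, Subtype.ext (h4.trans (h5.trans h1.symm))⟩

/-- Almost surely the random vector field is square integrable for the random measure. -/
theorem IsVersion.ae_memLp [StandardBorelSpace Ω] [IsFiniteMeasure P] (h : IsVersion m P μ K)
    (hm : m ≤ mΩ) {ξ : Ω → E d → E d} (hξ : Measurable (fun p : Ω × E d => ξ p.1 p.2))
    (hfin : ∀ᵐ ω ∂P, ∫⁻ ω', eLpNorm (ξ ω') 2 (μ ω : Measure (E d)) ^ 2 ∂(condExpKernel P m ω)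
      ≠ ∞) : ∀ᵐ ω ∂P, MemLp (ξ ω) 2 (μ ω : Measure (E d)) := by
  have hξω : ∀ ω, Measurable (ξ ω) := fun ω => hξ.comp measurable_prodMk_left
  have hK := h.measurable_of_le hm
  have hQ : ∀ᵐ ω ∂P, ∫⁻ x, ‖ξ ω x‖ₑ ^ 2 ∂(K ω) < ∞ := by
    -- The moment hypothesis evaluates a fresh field on the frozen measure `μ ω`. Under the
    -- conditional law `K ω'` equals that measure, so the finiteness returns to `P`; the version `K`
    -- supplies the measurability this requires.
    refine ae_of_ae_ae_condExpKernel hm (measurableSet_lt (measurable_lintegral_kernel hK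
      h.isProbabilityMeasure (hξ.enorm.pow_const 2)) measurable_const) ?_
    filter_upwards [hfin, h.ae_ae_eq hm] with ω h1 h2
    simp_rw [eLpNorm_two_sq] at h1
    have hmeas : Measurable (fun ω' => ∫⁻ x, ‖ξ ω' x‖ₑ ^ 2 ∂(μ ω : Measure (E d))) :=
      measurable_lintegral_kernel measurable_const (fun _ => inferInstance)
        (hξ.enorm.pow_const 2)
    filter_upwards [ae_lt_top hmeas h1, h2] with ω' h3 h4
    rwa [h4.1]
  filter_upwards [hQ, h.ae_eq] with ω h1 h2
  refine ⟨(hξω ω).aestronglyMeasurable, ?_⟩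
  rw [h2]
  rw [← eLpNorm_two_sq] at h1
  by_contra hc
  rw [not_lt, top_le_iff] at hc
  simp [hc] at h1

theorem ae_eq_map_of_step [IsFiniteMeasure P] {Θ : Set (E d)} (hΘ : IsClosed Θ) {pr : E d → E d}
    (hpr : IsMetricProjection Θ pr)
    (hopt : ∀ μ ν : P2 d, (optimalPlans (μ : Measure (E d)) (ν : Measure (E d))).Nonempty)
    {μ' : Ω → P2 d} {ξ : Ω → E d → E d} (hξω : ∀ ω, Measurable (ξ ω)) {τ : ℝ}
    (hLp : ∀ᵐ ω ∂P, MemLp (ξ ω) 2 (μ ω : Measure (E d)))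
    (hstep : ∀ᵐ ω ∂P, IsWassersteinProjection Θ
      ((μ ω : Measure (E d)).map (fun x => x - τ • ξ ω x)) (μ' ω)) :
    ∀ᵐ ω ∂P, (μ' ω : Measure (E d)) =
      (μ ω : Measure (E d)).map (fun x => pr (x - τ • ξ ω x)) := by
  filter_upwards [hLp, hstep] with ω h1 h2
  have hmeas : Measurable (fun x => x - τ • ξ ω x) := measurable_id.sub ((hξω ω).const_smul τ)
  have hLp' : MemLp (fun x => x - τ • ξ ω x) 2 (μ ω : Measure (E d)) :=
    (μ ω).memLp_id.sub (h1.const_smul τ)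
  have : IsProbabilityMeasure ((μ ω : Measure (E d)).map (fun x => x - τ • ξ ω x)) :=
    Measure.isProbabilityMeasure_map hmeas.aemeasurable
  rw [h2.eq_map hΘ hpr hopt (memLp_id_map hLp' hmeas), Measure.map_map hpr.measurable hmeas]
  rfl

/-- A projected gradient step moves the squared distance to a measure supported in `Θ` at most as
much as the unprojected step along a plan. -/
theorem eW2_map_projected_step_le {Θ : Set (E d)} (hΘ : IsClosed Θ) {pr : E d → E d}
    (hpr : IsMetricProjection Θ pr) {μ ν : Measure (E d)} (hν : ∀ᵐ x ∂ν, x ∈ Θ)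
    {γ : Measure (E d × E d)} (hγ : γ ∈ plans μ ν) {f : E d → E d} (hf : Measurable f) :
    eW2 (μ.map (fun x => pr (f x))) ν ≤ eLpNorm (fun p : E d × E d => f p.1 - p.2) 2 γ := by
  have hprf : Measurable (fun x => pr (f x)) := hpr.measurable.comp hf
  have h1 : μ.map (fun x => pr (f x)) = γ.map (fun p => pr (f p.1)) := by
    rw [← hγ.1, Measure.map_map hprf measurable_fst]
    rfl
  have hγΘ : ∀ᵐ p ∂γ, p.2 ∈ Θ := by
    rw [← hγ.2, ae_map_iff (p := (· ∈ Θ)) (by fun_prop) hΘ.measurableSet] at hν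
    exact hν
  have h2 : eW2 (μ.map (fun x => pr (f x))) ν ≤
      eLpNorm (fun p : E d × E d => pr (f p.1) - p.2) 2 γ := by
    rw [h1]
    nth_rw 1 [← hγ.2]
    exact eW2_map_map_le γ (hprf.comp measurable_fst) measurable_snd
  refine h2.trans (eLpNorm_mono_ae ?_)
  filter_upwards [hγΘ] with p hp
  have := hpr.norm_sub_le (f p.1) p.2
  rwa [hpr.apply_of_mem hp] at this

/-- One step of the iteration, conditionally on the past. -/
theorem ae_lintegral_W2_sq_le [StandardBorelSpace Ω] [IsFiniteMeasure P] {J : P2 d → ℝ}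
    {grad : P2 d → E d → E d} (hgrad : ∀ μ : P2 d, IsWassersteinGradient J μ (grad μ))
    {α : ℝ} (hα : 0 < α) (hJ : GeodesicallyConvex α J) {Θ : Set (E d)} (hΘ : IsClosed Θ)
    {pr : E d → E d} (hpr : IsMetricProjection Θ pr) {μstar : P2 d}
    (hsupp : (μstar : Measure (E d)).support ⊆ Θ) {σ C τ : ℝ} (hτ : 0 ≤ τ)
    (h : IsVersion m P μ K) (hm : m ≤ mΩ) {μ' : Ω → P2 d} {ξ : Ω → E d → E d}
    (hξ : Measurable (fun p : Ω × E d => ξ p.1 p.2))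
    (hstep : ∀ᵐ ω ∂P, (μ' ω : Measure (E d)) =
      (μ ω : Measure (E d)).map (fun x => pr (x - τ • ξ ω x)))
    (hmean : ∀ᵐ ω ∂P, ∀ᵐ x ∂(μ ω : Measure (E d)),
      ∫ ω', ξ ω' x ∂(condExpKernel P m ω) = grad (μ ω) x)
    (hbound : ∀ᵐ ω ∂P,
      ∫⁻ ω', eLpNorm (ξ ω') 2 (μ ω : Measure (E d)) ^ 2 ∂(condExpKernel P m ω)
        ≤ ENNReal.ofReal (σ ^ 2 + C * (J (μ ω) - J μstar))) :
    ∀ᵐ ω ∂P, ∫⁻ ω', ENNReal.ofReal (W2 (μ' ω') μstar ^ 2) ∂(condExpKernel P m ω) ≤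
      ENNReal.ofReal ((1 - τ * α) * W2 (μ ω) μstar ^ 2 - 2 * τ * (J (μ ω) - J μstar) +
        τ ^ 2 * max (σ ^ 2 + C * (J (μ ω) - J μstar)) 0) := by
  filter_upwards [h.ae_ae_eq hm, ae_ae_condExpKernel hm hstep, hmean, hbound] with ω h1 h2 h3 h4
  obtain ⟨γ, hγ, hineq⟩ := exists_optimalPlan_gradient_inequality (hgrad (μ ω)) hα hJ μstar
  have hΘae := (support_subset_iff_ae_mem hΘ).1 hsupp
  -- The maximum with `0` is the truncation implicit in `ENNReal.ofReal`; it matters when `J (μ ω)`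
  -- lies below `J μstar`, as can happen for the initial measure.
  have hstep' := lintegral_eLpNorm_gradient_step_le hξ hγ h3 (le_max_right _ 0)
    (h4.trans (ENNReal.ofReal_le_ofReal (le_max_left _ 0))) τ
  refine le_trans (lintegral_mono_ae ?_) (hstep'.trans (ENNReal.ofReal_le_ofReal ?_))
  · filter_upwards [h1, h2] with ω' h5 h6
    rw [ENNReal.ofReal_pow (W2_nonneg _ _), ofReal_W2, h6, h5.2]
    gcongr
    exact eW2_map_projected_step_le hΘ hpr hΘae hγ.1 (f := fun x => x - τ • ξ ω' x)
      (measurable_id.sub ((hξ.comp measurable_prodMk_left).const_smul τ))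
  · nlinarith [mul_le_mul_of_nonneg_left hineq hτ]

end Iterates

section Iteration

variable {Ω : Type*} [mΩ : MeasurableSpace Ω] [StandardBorelSpace Ω] {d : ℕ}

/-- All iterates have adapted measurable versions, and are images of their predecessors under the
projected gradient step. -/
theorem IsIteration.exists_isVersion {P : Measure Ω} [IsFiniteMeasure P] {ℱ : Filtration ℕ mΩ}
    {Θ : Set (E d)} (hΘ : IsClosed Θ) {pr : E d → E d} (hpr : IsMetricProjection Θ pr)
    (hopt : ∀ μ ν : P2 d, (optimalPlans (μ : Measure (E d)) (ν : Measure (E d))).Nonempty)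
    {τ : ℝ} {ξ : ℕ → Ω → E d → E d} {μ₀ : P2 d} {μ : ℕ → Ω → P2 d}
    (hμ : IsIteration P ℱ Θ τ ξ μ₀ μ)
    (hfin : ∀ k, ∀ᵐ ω ∂P,
      ∫⁻ ω', eLpNorm (ξ k ω') 2 (μ k ω : Measure (E d)) ^ 2 ∂(condExpKernel P (ℱ k) ω) ≠ ∞)
    (k : ℕ) : ∃ K, IsVersion (ℱ k) P (μ k) K := by
  induction k with
  | zero =>
    refine ⟨fun _ => μ₀, measurable_const, fun _ => inferInstance, ?_⟩
    filter_upwards [hμ.init] with ω hω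
    rw [hω]
  | succ k ih =>
    obtain ⟨K, hK⟩ := ih
    have hξ : Measurable (fun p : Ω × E d => ξ k p.1 p.2) :=
      (hμ.measurable k).mono (sup_le_sup (MeasurableSpace.comap_mono (ℱ.le _)) le_rfl) le_rfl
    have hξω : ∀ ω, Measurable (ξ k ω) := fun ω => hξ.comp measurable_prodMk_left
    -- Uniqueness of the projection leaves no choice in the next iterate, so the pushforward is a
    -- version of it. It is measurable only for `ℱ (k + 1)`, where `ξ k` is revealed.
    refine ⟨fun ω => (K ω).map (fun x => pr (x - τ • ξ k ω x)), ?_, fun ω => ?_, ?_⟩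
    · exact @measurable_gradient_step_map _ _ (ℱ (k + 1)) _
        (hK.measurable.mono (ℱ.mono k.le_succ) le_rfl)
        hK.isProbabilityMeasure _ (hμ.measurable k) _ hpr.measurable τ
    · have := hK.isProbabilityMeasure ω
      exact Measure.isProbabilityMeasure_map
        (hpr.measurable.comp (measurable_id.sub ((hξω ω).const_smul τ))).aemeasurable
    · filter_upwards [hK.ae_eq, ae_eq_map_of_step hΘ hpr hopt hξω
        (hK.ae_memLp (ℱ.le k) hξ (hfin k)) (hμ.step k)] with ω h1 h2
      rw [h2, h1]

end Iteration

/-! ### From second moments to asymptotic bounds. -/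

/-- Passing from second moments to first moments in the limit. -/
theorem limsup_integral_le_of_sq_le {Ω : Type*} [MeasurableSpace Ω] {P : Measure Ω}
    [IsProbabilityMeasure P] {X W : ℕ → Ω → ℝ} {L q A c : ℝ} (hL : 0 ≤ L) (hq0 : 0 ≤ q)
    (hq1 : q < 1) (hX : ∀ k, AEStronglyMeasurable (X k) P)
    (hW : ∀ k, MemLp (W k) 2 P) (hW0 : ∀ k ω, 0 ≤ W k ω)
    (hX0 : ∀ k ω, 0 ≤ X k ω) (hXW : ∀ k ω, X k ω ≤ L * W k ω)
    (hbound : ∀ k, ∫ ω, W k ω ^ 2 ∂P ≤ q ^ k * A + c) :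
    (∀ k, Integrable (X k) P) ∧
      limsup (fun k : ℕ => ((∫ ω, X k ω ∂P : ℝ) : EReal)) atTop ≤
        ((L * Real.sqrt c : ℝ) : EReal) := by
  have hWi : ∀ k, Integrable (W k) P := fun k => (hW k).integrable (by norm_num)
  have hXi : ∀ k, Integrable (X k) P := fun k => by
    refine ((hWi k).const_mul L).mono (hX k) (ae_of_all _ fun ω => ?_)
    rw [Real.norm_of_nonneg (hX0 k ω),
      Real.norm_of_nonneg (mul_nonneg hL (hW0 k ω))]
    exact hXW k ω
  refine ⟨hXi, ?_⟩
  have hle : ∀ k, ∫ ω, X k ω ∂P ≤ L * Real.sqrt (q ^ k * A + c) := fun k => by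
    have h1 : ∫ ω, X k ω ∂P ≤ L * ∫ ω, W k ω ∂P := by
      rw [← integral_const_mul]
      exact integral_mono (hXi k) ((hWi k).const_mul L) (hXW k)
    -- Jensen's inequality, in the form of nonnegative variance.
    have h2 : (∫ ω, W k ω ∂P) ^ 2 ≤ ∫ ω, W k ω ^ 2 ∂P := by
      have hv := variance_nonneg (W k) P
      rw [variance_eq_sub (hW k)] at hv
      simp only [Pi.pow_apply] at hv
      linarith
    refine h1.trans (mul_le_mul_of_nonneg_left ?_ hL)
    exact Real.le_sqrt_of_sq_le (h2.trans (hbound k))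
  have hlim : Tendsto (fun k : ℕ => L * Real.sqrt (q ^ k * A + c)) atTop
      (𝓝 (L * Real.sqrt c)) := by
    have h1 : Tendsto (fun k : ℕ => q ^ k * A + c) atTop (𝓝 (0 * A + c)) :=
      ((tendsto_pow_atTop_nhds_zero_of_lt_one hq0 hq1).mul_const A).add_const c
    rw [zero_mul, zero_add] at h1
    exact (h1.sqrt).const_mul L
  have hlimE : Tendsto (fun k : ℕ => ((L * Real.sqrt (q ^ k * A + c) : ℝ) : EReal)) atTop
      (𝓝 ((L * Real.sqrt c : ℝ) : EReal)) :=
    (continuous_coe_real_ereal.tendsto _).comp hlim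
  rw [← hlimE.limsup_eq]
  exact limsup_le_limsup (Eventually.of_forall fun k => EReal.coe_le_coe_iff.2 (hle k))

end WassersteinGF

/-! ### The main theorem. -/

theorem theorem1 {d : ℕ} {Ω : Type*} [mΩ : MeasurableSpace Ω] [StandardBorelSpace Ω]
    (P : Measure Ω) [IsProbabilityMeasure P] (ℱ : Filtration ℕ mΩ)
    (J : P2 d → ℝ) (grad : P2 d → E d → E d)
    (hgrad : ∀ μ : P2 d, IsWassersteinGradient J μ (grad μ))
    (α : ℝ) (hα : 0 < α) (hJ : GeodesicallyConvex α J)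
    (Θ : Set (E d)) (hΘ_closed : IsClosed Θ) (hΘ_convex : Convex ℝ Θ)
    (μstar : P2 d) (hμstar : IsOptimal J Θ μstar)
    (σ C τ : ℝ) (hσ : 0 < σ) (hC : 0 < C) (hτ_pos : 0 < τ) (hτ : τ < min (1 / α) (2 / C))
    (μ₀ : P2 d) (ξ : ℕ → Ω → E d → E d) (μ : ℕ → Ω → P2 d)
    (hμ : IsIteration P ℱ Θ τ ξ μ₀ μ)
    (hξ_mean : IsUnbiased P ℱ grad ξ μ)
    (hξ_bound : HasSecondMomentBound P ℱ J μstar σ C ξ μ) :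
    -- the expected squared distances are finite, with the finite-time bounds
    (∀ k, Integrable (fun ω => W2 (μ (k + 1) ω) μstar ^ 2) P) ∧
    (J μstar ≤ J μ₀ → ∀ k, ∫ ω, W2 (μ (k + 1) ω) μstar ^ 2 ∂P ≤
      (1 - τ * α) ^ (k + 1) * (W2 μ₀ μstar ^ 2 - τ * σ ^ 2 / α) + τ * σ ^ 2 / α) ∧
    (∀ k, ∫ ω, W2 (μ (k + 1) ω) μstar ^ 2 ∂P ≤
      (1 - τ * α) ^ k * ((∫ ω, W2 (μ 1 ω) μstar ^ 2 ∂P) - τ * σ ^ 2 / α) + τ * σ ^ 2 / α) ∧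
    -- asymptotic bound on the expected distance
    ((∀ k, Integrable (fun ω => W2 (μ (k + 1) ω) μstar) P) ∧
      limsup (fun k : ℕ => ((∫ ω, W2 (μ (k + 1) ω) μstar ∂P : ℝ) : EReal)) atTop ≤
        ((Real.sqrt (τ * σ ^ 2 / α) : ℝ) : EReal)) ∧
    -- asymptotic bound on means and covariances
    ((∀ k, Integrable (fun ω => Real.sqrt (‖mean (μ (k + 1) ω) - mean μstar‖ ^ 2 +
        bures (covMatrix (μ (k + 1) ω)) (covMatrix μstar) ^ 2)) P) ∧
      limsup (fun k : ℕ => ((∫ ω, Real.sqrt (‖mean (μ (k + 1) ω) - mean μstar‖ ^ 2 +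
        bures (covMatrix (μ (k + 1) ω)) (covMatrix μstar) ^ 2) ∂P : ℝ) : EReal)) atTop ≤
        ((Real.sqrt (τ * σ ^ 2 / α) : ℝ) : EReal)) ∧
    -- asymptotic bound on the L² norms of Lipschitz functions
    (∀ (L : ℝ≥0) (φ : E d → ℝ), LipschitzWith L φ →
      (∀ k, Integrable (fun ω => |l2norm φ (μ (k + 1) ω) - l2norm φ μstar|) P) ∧
      limsup (fun k : ℕ =>
        ((∫ ω, |l2norm φ (μ (k + 1) ω) - l2norm φ μstar| ∂P : ℝ) : EReal)) atTop ≤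
        ((L * Real.sqrt (τ * σ ^ 2 / α) : ℝ) : EReal)) := by
  have hJ_opt : ∀ μ ν : P2 d, (optimalPlans (μ : Measure (E d)) (ν : Measure (E d))).Nonempty :=
    hJ.optimalPlans_nonempty
  have hτα : τ * α < 1 := by
    have h := hτ.trans_le (min_le_left _ _)
    rwa [lt_div_iff₀ hα] at h
  have hτC : τ * C < 2 := by
    have h := hτ.trans_le (min_le_right _ _)
    rwa [lt_div_iff₀ hC] at h
  have hΘ_nonempty : Θ.Nonempty :=
    (Measure.nonempty_support (IsProbabilityMeasure.ne_zero (μstar : Measure (E d)))).mono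
      hμstar.1
  obtain ⟨pr, hpr⟩ := exists_isMetricProjection hΘ_closed hΘ_convex hΘ_nonempty
  have hξ : ∀ k, Measurable (fun p : Ω × E d => ξ k p.1 p.2) := fun k =>
    (hμ.measurable k).mono (sup_le_sup (MeasurableSpace.comap_mono (ℱ.le _)) le_rfl) le_rfl
  have hfin : ∀ k, ∀ᵐ ω ∂P, ∫⁻ ω', eLpNorm (ξ k ω') 2 (μ k ω : Measure (E d)) ^ 2
      ∂(condExpKernel P (ℱ k) ω) ≠ ∞ := fun k => by
    filter_upwards [hξ_bound k] with ω hω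
    exact (hω.trans_lt ENNReal.ofReal_lt_top).ne
  choose K hK using hμ.exists_isVersion hΘ_closed hpr hJ_opt hfin
  have hWm : ∀ k, AEMeasurable (fun ω => W2 (μ k ω) μstar) P := fun k =>
    (hK k).aemeasurable_W2 (ℱ.le k) μstar
  have hW2m : ∀ k, AEMeasurable (fun ω => ENNReal.ofReal (W2 (μ k ω) μstar ^ 2)) P := fun k =>
    ((hWm k).pow_const 2).ennreal_ofReal
  -- The recursion is first run in `ℝ≥0∞`, because integrability of the squared distances is itself
  -- a consequence of it.
  set a : ℕ → ℝ≥0∞ := fun k => ∫⁻ ω, ENNReal.ofReal (W2 (μ k ω) μstar ^ 2) ∂P with ha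
  have hstep : ∀ k, ∀ᵐ ω ∂P,
      ∫⁻ ω', ENNReal.ofReal (W2 (μ (k + 1) ω') μstar ^ 2) ∂(condExpKernel P (ℱ k) ω) ≤
      ENNReal.ofReal ((1 - τ * α) * W2 (μ k ω) μstar ^ 2 - 2 * τ * (J (μ k ω) - J μstar) +
        τ ^ 2 * max (σ ^ 2 + C * (J (μ k ω) - J μstar)) 0) := fun k =>
    ae_lintegral_W2_sq_le hgrad hα hJ hΘ_closed hpr hμstar.1 hτ_pos.le (hK k) (ℱ.le k) (hξ k)
      (ae_eq_map_of_step hΘ_closed hpr hJ_opt (fun ω => (hξ k).comp measurable_prodMk_left)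
        ((hK k).ae_memLp (ℱ.le k) (hξ k) (hfin k)) (hμ.step k)) (hξ_mean k) (hξ_bound k)
  have hrec : ∀ k, (∀ᵐ ω ∂P, J μstar ≤ J (μ k ω)) →
      a (k + 1) ≤ ENNReal.ofReal (1 - τ * α) * a k + ENNReal.ofReal (τ ^ 2 * σ ^ 2) := by
    intro k hJk
    rw [ha]
    simp only
    rw [← lintegral_condExpKernel (ℱ.le k) (hW2m (k + 1)),
      ← lintegral_const_mul' _ _ ENNReal.ofReal_ne_top]
    calc _ ≤ ∫⁻ ω, (ENNReal.ofReal (1 - τ * α) * ENNReal.ofReal (W2 (μ k ω) μstar ^ 2) +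
          ENNReal.ofReal (τ ^ 2 * σ ^ 2)) ∂P := by
          refine lintegral_mono_ae ?_
          filter_upwards [hstep k, hJk] with ω h1 h2
          refine h1.trans ?_
          rw [← ENNReal.ofReal_mul (by linarith), ← ENNReal.ofReal_add
            (mul_nonneg (by linarith) (sq_nonneg _)) (by positivity)]
          apply ENNReal.ofReal_le_ofReal
          rw [max_eq_left (add_nonneg (sq_nonneg σ)
            (mul_nonneg hC.le (sub_nonneg.2 h2)))]
          -- This is where `τ < 2 / C` enters: the descent term absorbs the part of the noise
          -- proportional to the optimality gap.
          have h3 : 0 ≤ τ * (2 - τ * C) * (J (μ k ω) - J μstar) :=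
            mul_nonneg (mul_nonneg hτ_pos.le (by linarith)) (by linarith)
          nlinarith
      _ = _ := by
          rw [lintegral_add_right _ measurable_const]
          simp
  have hJsucc : ∀ k, ∀ᵐ ω ∂P, J μstar ≤ J (μ (k + 1) ω) := fun k => by
    filter_upwards [hμ.step k] with ω hω
    exact hμstar.2 _ hω.1
  have ha0 : a 0 = ENNReal.ofReal (W2 μ₀ μstar ^ 2) := by
    have : a 0 = ∫⁻ _, ENNReal.ofReal (W2 μ₀ μstar ^ 2) ∂P := by
      refine lintegral_congr_ae ?_
      filter_upwards [hμ.init] with ω hω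
      rw [hω]
    rw [this]
    simp
  -- The first step cannot use `hrec`, since `J μ₀` may lie below `J μstar`; the untruncated
  -- one-step bound is a finite constant there because `μ₀` is deterministic.
  have hafin : ∀ k, a k ≠ ∞ := by
    intro k
    rcases k with _ | k
    · rw [ha0]; exact ENNReal.ofReal_ne_top
    · induction k with
      | zero =>
        have h1 : a (0 + 1) ≤ ∫⁻ _, ENNReal.ofReal ((1 - τ * α) * W2 μ₀ μstar ^ 2 -
            2 * τ * (J μ₀ - J μstar) + τ ^ 2 * max (σ ^ 2 + C * (J μ₀ - J μstar)) 0) ∂P := by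
          rw [ha]
          simp only
          rw [← lintegral_condExpKernel (ℱ.le 0) (hW2m (0 + 1))]
          refine lintegral_mono_ae ?_
          filter_upwards [hstep 0, hμ.init] with ω h1 h2
          rwa [h2] at h1
        refine (h1.trans_lt ?_).ne
        simp
      | succ k ih =>
        refine ((hrec (k + 1) (hJsucc k)).trans_lt ?_).ne
        exact ENNReal.add_lt_top.2 ⟨ENNReal.mul_lt_top ENNReal.ofReal_lt_top ih.lt_top,
          ENNReal.ofReal_lt_top⟩
  have hint : ∀ k, Integrable (fun ω => W2 (μ k ω) μstar ^ 2) P := fun k => by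
    refine ⟨((hWm k).pow_const 2).aestronglyMeasurable, ?_⟩
    rw [hasFiniteIntegral_iff_ofReal (ae_of_all _ fun ω => sq_nonneg _)]
    exact (hafin k).lt_top
  have haA : ∀ k, a k = ENNReal.ofReal (∫ ω, W2 (μ k ω) μstar ^ 2 ∂P) := fun k =>
    (ofReal_integral_eq_lintegral_ofReal (hint k) (ae_of_all _ fun ω => sq_nonneg _)).symm
  have hA0 : ∀ k, 0 ≤ ∫ ω, W2 (μ k ω) μstar ^ 2 ∂P := fun k =>
    integral_nonneg fun ω => sq_nonneg _
  set c := τ * σ ^ 2 / α with hc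
  -- Subtracting the fixed point `c` of `x ↦ (1 - τα) x + τ²σ²` makes the recursion purely
  -- geometric.
  have hrecR : ∀ k, (∀ᵐ ω ∂P, J μstar ≤ J (μ k ω)) →
      (∫ ω, W2 (μ (k + 1) ω) μstar ^ 2 ∂P) - c ≤
        (1 - τ * α) * ((∫ ω, W2 (μ k ω) μstar ^ 2 ∂P) - c) := by
    intro k hJk
    have h1 := hrec k hJk
    rw [haA, haA, ← ENNReal.ofReal_mul (by linarith), ← ENNReal.ofReal_add
      (mul_nonneg (by linarith) (hA0 k)) (by positivity), ENNReal.ofReal_le_ofReal_iff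
      (add_nonneg (mul_nonneg (by linarith) (hA0 k)) (by positivity))] at h1
    have h2 : τ * α * c = τ ^ 2 * σ ^ 2 := by
      rw [hc]; field_simp
    linarith
  have hgeneral : ∀ k, (∫ ω, W2 (μ (k + 1) ω) μstar ^ 2 ∂P) - c ≤
      (1 - τ * α) ^ k * ((∫ ω, W2 (μ 1 ω) μstar ^ 2 ∂P) - c) := by
    intro k
    induction k with
    | zero => simp
    | succ k ih =>
      refine (hrecR (k + 1) (hJsucc k)).trans ?_
      rw [pow_succ', mul_assoc]
      exact mul_le_mul_of_nonneg_left ih (by linarith)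
  have hbound : ∀ k, ∫ ω, W2 (μ (k + 1) ω) μstar ^ 2 ∂P ≤
      (1 - τ * α) ^ k * ((∫ ω, W2 (μ 1 ω) μstar ^ 2 ∂P) - c) + c := fun k => by
    linarith [hgeneral k]
  have hLp : ∀ k, MemLp (fun ω => W2 (μ (k + 1) ω) μstar) 2 P := fun k =>
    (memLp_two_iff_integrable_sq (hWm (k + 1)).aestronglyMeasurable).2 (hint (k + 1))
  have hq0 : 0 ≤ 1 - τ * α := by linarith
  have hq1 : 1 - τ * α < 1 := by linarith [mul_pos hτ_pos hα]
  refine ⟨fun k => hint (k + 1), fun hJ0 k => ?_, hbound, ?_, ?_, fun L φ hφ => ?_⟩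
  · have hone : (∫ ω, W2 (μ 1 ω) μstar ^ 2 ∂P) - c ≤ (1 - τ * α) * (W2 μ₀ μstar ^ 2 - c) := by
      have h1 := hrecR 0 (by filter_upwards [hμ.init] with ω hω; rwa [hω])
      have h2 : ∫ ω, W2 (μ 0 ω) μstar ^ 2 ∂P = W2 μ₀ μstar ^ 2 := by
        have h3 := haA 0
        rw [ha0, ENNReal.ofReal_eq_ofReal_iff (sq_nonneg _) (hA0 0)] at h3
        exact h3.symm
      rwa [h2] at h1
    have h1 := hgeneral k
    have h2 := mul_le_mul_of_nonneg_left hone (pow_nonneg hq0 k)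
    rw [pow_succ, mul_assoc]
    linarith
  · simpa using limsup_integral_le_of_sq_le zero_le_one hq0 hq1
      (fun k => (hWm (k + 1)).aestronglyMeasurable) hLp (fun k ω => W2_nonneg _ _)
      (fun k ω => W2_nonneg _ _) (fun k ω => (one_mul _).ge) hbound
  · simpa using limsup_integral_le_of_sq_le zero_le_one hq0 hq1
      (fun k => ((hK (k + 1)).aemeasurable_sqrt_mean_bures (ℱ.le _) μstar).aestronglyMeasurable)
      hLp (fun k ω => W2_nonneg _ _) (fun k ω => Real.sqrt_nonneg _)
      (fun k ω => (sqrt_mean_bures_le_W2 (hJ_opt _ _)).trans (one_mul _).ge) hbound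
  · exact limsup_integral_le_of_sq_le L.2 hq0 hq1
      (fun k => ((hK (k + 1)).aemeasurable_abs_l2norm_sub (ℱ.le _) hφ.continuous.measurable
        μstar).aestronglyMeasurable)
      hLp (fun k ω => W2_nonneg _ _) (fun k ω => abs_nonneg _)
      (fun k ω => abs_l2norm_sub_le hφ (hJ_opt _ _)) hbound
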